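/- Let $\mathfrak g=V_1\oplus\cdots\oplus V_r$ be a stratified real Lie algebra of step $r\ge 1$ (finite-dimensional, $[V_1,V_i]=V_{i+1}$ for $1\le i<r$, $[V_1,V_r]=0$, $V_r\neq 0$), and let $\mathbb G$ be the corresponding connected, simply connected Lie group (Carnot group), written in the exponential coordinates $x=(x^{(1)},\dots,x^{(r)})\in\mathbb R^n$, $x^{(i)}\in\mathbb R^{\dim V_i}$, of a basis of $\mathfrak g$ adapted to the stratification; its group law is given by the Baker–Campbell–Hausdorff formula and its Haar measure $\mu$ is the Lebesgue measure. Let $Q=\sum_{i=1}^r i\dim V_i$ be the homogeneous dimension, $\Delta_{\mathbb G}=\sum_k X_k^2$ the sub-Laplacian, where $X_1,\dots,X_{\dim V_1}$ are the left-invariant vector fields given by the basis of $V_1$, $|x|_{\mathbb G}=\big(\sum_{i=1}^r|x^{(i)}|^{2r!/i}\big)^{1/(2r!)}$, and $B_R=\{x:|x|_{\mathbb G}<R\}$. For $p>1$, $\sigma>0$, $u_0,u_1\in L^1_{\rm loc}(\mathbb G)$ and $0<T\le\infty$, a weak solution in $[0,T)\times\mathbb G$ of $$\partial_{tt}u-\Delta_{\mathbb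 G}u\ge|u|^p,\qquad u(0,\cdot)=u_0,\qquad \partial_tu(0,\cdot)=\sigma u_1$$ is a function $u\in L^p_{\rm loc}([0,T)\times\mathbb G)$ such that for every $0\le\varphi\in C_0^\infty([0,T)\times\mathbb G)$ $$\int_0^T\!\!\int_{\mathbb G}|u|^p\varphi\,d\mu\,dt+\sigma\int_{\mathbb G}u_1\varphi(0,\cdot)\,d\mu-\int_{\mathbb G}u_0\,\partial_t\varphi(0,\cdot)\,d\mu\le-\int_0^T\!\!\int_{\mathbb G}u\,(\partial_{tt}+\Delta_{\mathbb G})\varphi\,d\mu\,dt .$$ Let $T(\sigma)$ be the supremum of all $T\in(0,\infty]$ for which a weak solution in $[0,T)\times\mathbb G$ exists. **Theorem.** Let $1<p\le\frac{Q+1}{Q-1}$ (that is, $1<p<\infty$ if $Q=1$), and let $u_1\in L^1_{\rm loc}(\mathbb G)$ satisfy $\liminf_{R\to\infty}\int_{B_R}u_1\,d\mu>0$. Then there are $\sigma_0>0$ and $C>0$, depending only on $\mathbb G$, the adapted basis, $p$ and $u_1$, such that for every $u_0\in L^1_{\rm loc}(\mathbb G)$ and every $\sigma\in(0,\sigma_0]$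 $$T(\sigma)\le\begin{cases}C\,\sigma^{-\left(\frac{p+1}{p-1}-Q\right)^{-1}}&\text{if }p<\frac{Q+1}{Q-1},\\[4pt]\exp\!\big(C\sigma^{-(p-1)}\big)&\text{if }p=\frac{Q+1}{Q-1}.\end{cases}$$ -/

import Mathlib

open MeasureTheory Filter Set
open scoped ContDiff Nat

noncomputable section

namespace Carnot

/-! ### The group law of a simply connected nilpotent Lie group in exponential coordinates -/

section BCH

variable {𝔤 : Type*} [LieRing 𝔤]

/-- The right-nested bracket `[a₁,[a₂,[…,[aₘ₋₁,aₘ]…]]]` of a word `a₁ a₂ … aₘ`. -/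
def nestedBracket : List 𝔤 → 𝔤
  | [] => 0
  | [a] => a
  | a :: b :: l => ⁅a, nestedBracket (b :: l)⁆

/-- The word `X^{p₁} Y^{q₁} ⋯ X^{pₖ} Y^{qₖ}`, where `e i = (pᵢ, qᵢ)`. -/
def dynkinWord {k : ℕ} (e : Fin k → ℕ × ℕ) (X Y : 𝔤) : List 𝔤 :=
  (List.ofFn fun i => List.replicate (e i).1 X ++ List.replicate (e i).2 Y).flatten

/-- The index set of Dynkin's formula with `k` blocks: all `(pᵢ, qᵢ)`, `i = 1, …, k`, with
`pᵢ + qᵢ > 0` for every `i` and total degree `∑ (pᵢ + qᵢ) ≤ r`. -/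
def dynkinIndex (r k : ℕ) : Finset (Fin k → ℕ × ℕ) :=
  (Fintype.piFinset fun _ : Fin k => Finset.range (r + 1) ×ˢ Finset.range (r + 1)).filter
    fun e => (∀ i, 0 < (e i).1 + (e i).2) ∧ ∑ i, ((e i).1 + (e i).2) ≤ r

variable [LieAlgebra ℝ 𝔤]

/-- The Baker–Campbell–Hausdorff product `log (exp X · exp Y)`, given by Dynkin's formula
`∑ₖ (-1)^(k-1)/k ∑ [X^{p₁}Y^{q₁}⋯X^{pₖ}Y^{qₖ}] / (∑ (pᵢ+qᵢ) · ∏ pᵢ! qᵢ!)`. Only terms of degree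
at most `r` are kept; in a Lie algebra that is nilpotent of step `r` the others vanish. -/
def bch (r : ℕ) (X Y : 𝔤) : 𝔤 :=
  ∑ k ∈ Finset.Icc 1 r, ((-1 : ℝ) ^ (k - 1) / (k : ℝ)) •
    ∑ e ∈ dynkinIndex r k,
      (((∑ i, ((e i).1 + (e i).2) : ℕ) : ℝ) *
        ∏ i, (((e i).1 ! : ℝ) * ((e i).2 ! : ℝ)))⁻¹ • nestedBracket (dynkinWord e X Y)

end BCH

/-! ### Stratified Lie algebras -/

/-- A stratification of step `r` of a real Lie algebra: `𝔤 = V₁ ⊕ ⋯ ⊕ Vᵣ` with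
`[V₁, Vᵢ] = Vᵢ₊₁` for `1 ≤ i < r`, `[V₁, Vᵣ] = 0` and `Vᵣ ≠ 0`. The strata are numbered from `1`;
the value `V 0` is never used. The bracket `[V, W]` of two subspaces is the linear span of all
`[x, y]` with `x ∈ V` and `y ∈ W`. -/
structure Stratification (𝔤 : Type*) [LieRing 𝔤] [LieAlgebra ℝ 𝔤] (r : ℕ) where
  V : ℕ → Submodule ℝ 𝔤
  pos : 0 < r
  isInternal : DirectSum.IsInternal fun i : Fin r => V (i + 1)
  bracket_eq : ∀ i, 1 ≤ i → i < r →
    Submodule.span ℝ {z | ∃ x ∈ V 1, ∃ y ∈ V i, ⁅x, y⁆ = z} = V (i + 1)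
  bracket_last : ∀ x ∈ V 1, ∀ y ∈ V r, ⁅x, y⁆ = 0
  last_ne_bot : V r ≠ ⊥

namespace Stratification

variable {𝔤 : Type*} [LieRing 𝔤] [LieAlgebra ℝ 𝔤] {r : ℕ} (S : Stratification 𝔤 r)

/-- `S.dim i` is the dimension of the stratum `V (i + 1)`, for `i = 0, …, r - 1`. -/
def dim (i : Fin r) : ℕ := Module.finrank ℝ (S.V (i + 1))

/-- The homogeneous dimension `Q = ∑ i · dim Vᵢ`. -/
def homDim : ℕ := ∑ i : Fin r, ((i : ℕ) + 1) * S.dim i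

/-- A basis of `𝔤` adapted to the stratification: `basis ⟨i, j⟩ = X_{j+1}^{(i+1)}` lies in
`V (i + 1)`. -/
structure AdaptedBasis where
  basis : Module.Basis (Σ i : Fin r, Fin (S.dim i)) ℝ 𝔤
  mem : ∀ (i : Fin r) (j : Fin (S.dim i)), basis ⟨i, j⟩ ∈ S.V (i + 1)

/-- The Carnot group of a stratified Lie algebra in the exponential coordinates of an adapted
basis: the space `ℝⁿ`, with points `x = (x^{(1)}, …, x^{(r)})`. Its Haar measure is the Lebesgue
measure `volume`. -/
abbrev Point : Type := (Σ i : Fin r, Fin (S.dim i)) → ℝ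

/-- The homogeneous norm `|x| = (∑ᵢ |x^{(i)}|^{2 r!/i})^{1/(2 r!)}` (the exponents `2 r!/i`,
`1 ≤ i ≤ r`, are integers). -/
def homNorm (x : S.Point) : ℝ :=
  (∑ i : Fin r, Real.sqrt (∑ j, x ⟨i, j⟩ ^ 2) ^ (2 * r ! / ((i : ℕ) + 1))) ^
    ((1 : ℝ) / ((2 * r ! : ℕ) : ℝ))

/-- The ball `B_R(0)` of the homogeneous distance `d(x, y) = |y⁻¹ x|` about the identity `0`. -/
def ball (R : ℝ) : Set S.Point := {x | S.homNorm x < R}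

/-- The set `[0, T) × 𝔾`. -/
def slab (T : EReal) : Set (ℝ × S.Point) := {z | 0 ≤ z.1 ∧ (z.1 : EReal) < T}

/-- The nonnegative functions in `C₀^∞([0, T) × 𝔾)`: smooth up to the boundary `t = 0`, of compact
support in `[0, T) × 𝔾`. They are given as restrictions to `t ≥ 0` of smooth functions of compact
support in `(-∞, T) × 𝔾`, and nonnegativity is required for `t ≥ 0` only. -/
structure IsTestFunction (T : EReal) (ψ : ℝ × S.Point → ℝ) : Prop where
  contDiff : ContDiff ℝ ∞ ψ
  hasCompactSupport : HasCompactSupport ψ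
  tsupport_subset : ∀ z ∈ tsupport ψ, (z.1 : EReal) < T
  nonneg : ∀ z : ℝ × S.Point, 0 ≤ z.1 → 0 ≤ ψ z

namespace AdaptedBasis

variable {S} (b : S.AdaptedBasis)

/-- The group law of the Carnot group, in exponential coordinates. -/
def mul (x y : S.Point) : S.Point :=
  b.basis.equivFun (bch r (b.basis.equivFun.symm x) (b.basis.equivFun.symm y))

/-- The left-invariant vector field `X_k`, `k = 1, …, dim V₁`, of the horizontal layer:
`X_k f (x) = d/dt f (x · exp (t X_k))` at `t = 0`. -/
def horizontalField (k : Fin (S.dim ⟨0, S.pos⟩)) (f : S.Point → ℝ) (x : S.Point) : ℝ :=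
  deriv (fun t : ℝ => f (b.mul x (t • Pi.single ⟨⟨0, S.pos⟩, k⟩ 1))) 0

/-- The sub-Laplacian `Δ_𝔾 = ∑ₖ X_k²`. -/
def subLaplacian (f : S.Point → ℝ) (x : S.Point) : ℝ :=
  ∑ k, b.horizontalField k (b.horizontalField k f) x

/-- `u` is a weak solution in `[0, T) × 𝔾` of `∂ₜₜ u - Δ_𝔾 u ≥ |u|^p`, `u(0, ·) = u₀`,
`∂ₜ u(0, ·) = σ u₁`. -/
structure IsWeakSolution (p σ : ℝ) (u₀ u₁ : S.Point → ℝ) (T : EReal)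
    (u : ℝ × S.Point → ℝ) : Prop where
  memLp_loc : ∀ K ⊆ S.slab T, IsCompact K → MemLp u (ENNReal.ofReal p) (volume.restrict K)
  inequality : ∀ ψ, S.IsTestFunction T ψ →
    (∫ z in S.slab T, |u z| ^ p * ψ z) + σ * (∫ x, u₁ x * ψ (0, x))
        - (∫ x, u₀ x * deriv (fun t : ℝ => ψ (t, x)) 0)
      ≤ - ∫ z in S.slab T, u z *
          (iteratedDeriv 2 (fun t : ℝ => ψ (t, z.2)) z.1
            + b.subLaplacian (fun x => ψ (z.1, x)) z.2)

/-- The lifespan `T(σ)`: the supremum of all `T ∈ (0, ∞]` such that the problem has a weak solution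
in `[0, T) × 𝔾`. -/
def lifespan (p σ : ℝ) (u₀ u₁ : S.Point → ℝ) : EReal :=
  sSup {T : EReal | 0 < T ∧ ∃ u, b.IsWeakSolution p σ u₀ u₁ T u}

end AdaptedBasis

end Stratification

end Carnot

end

/-! ### The Baker–Campbell–Hausdorff product: naturality and right unit. -/

namespace Carnot

section BCHLemmas

variable {𝔤 𝔥 : Type*}

/-! The proof is the test-function method, with a cutoff built from the polynomial space-time gauge
`N(t,x) = t^m + |x|^m`, `m = 2 r!`. Dilations respect the bracket, hence the product, so each `X_k`
lowers the degree of homogeneity by one. Since `N` is smooth and homogeneous of degree `m`,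
compactness gives `|∇N|² ≲ ρ^(2m-2)` and `|(∂ₜₜ + Δ)N| ≲ ρ^(m-2)` with `ρ = N^(1/m)`.

Take `φ = F ∘ N` with `F` equal to `1` for `ρ ≤ R` and `0` for `ρ ≥ R eⁿ`, interpolating in `log ρ`.
Then `|(∂ₜₜ + Δ)φ| ≲ n⁻¹ ρ⁻² φ^(1/p)` (`exists_bound_waveCutoff`). Young's inequality bounds the
right-hand side of the weak inequality by `∫ |u|^p φ`, which cancels, plus a term free of `u`. The
datum `u₀` drops out because `∂ₜφ = 0` at `t = 0`. Summing over the shells `ρ ~ R eᵏ`, of volume `≲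
(R eᵏ)^(Q+1)`, yields `exists_integral_mul_logCutoff_le`: `σ ∫ u₁ φ(0,·) ≤ K n^(-q) ∑_{k<n} (R
eᵏ)^(-α)`, with `α = 2q - Q - 1 = (p+1)/(p-1) - Q` and `1/p + 1/q = 1`.

The integral on the left is at least some `c > 0` although `u₁` may change sign: `φ(0,·)` is
radially decreasing, so by the layer-cake formula the integral averages those of `u₁` over balls of
radius at least `R` (`le_integral_mul_logCutoff`). In the subcritical case `n = 1` and `R ~
σ^(-1/α)` give a contradiction. In the critical case `α = 0`, the right-hand side is `K n^(1-q) = K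
n^(-1/(p-1))`, and one fixes `R` and takes `n ~ σ^(-(p-1))`; the support then has size `R eⁿ`,
whence the exponential. -/

theorem dynkinWord_map {k : ℕ} (e : Fin k → ℕ × ℕ) (f : 𝔤 → 𝔥) (X Y : 𝔤) :
    dynkinWord e (f X) (f Y) = (dynkinWord e X Y).map f := by
  simp [dynkinWord, List.map_flatten, List.map_ofFn, Function.comp_def]

theorem mem_dynkinWord_right {k : ℕ} (e : Fin k → ℕ × ℕ) (X Y : 𝔤) (i : Fin k)
    (h : (e i).2 ≠ 0) : Y ∈ dynkinWord e X Y := by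
  simp only [dynkinWord, List.mem_flatten, List.mem_ofFn]
  exact ⟨_, ⟨i, rfl⟩, by simp [h]⟩

theorem length_dynkinWord {k : ℕ} (e : Fin k → ℕ × ℕ) (X Y : 𝔤) :
    (dynkinWord e X Y).length = ∑ i, ((e i).1 + (e i).2) := by
  simp [dynkinWord, List.length_flatten, List.map_ofFn, Function.comp_def, List.sum_ofFn]

variable [LieRing 𝔤] [LieRing 𝔥]

theorem nestedBracket_map (f : 𝔤 → 𝔥) (h0 : f 0 = 0) (hf : ∀ x y, f ⁅x, y⁆ = ⁅f x, f y⁆) :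
    ∀ l : List 𝔤, nestedBracket (l.map f) = f (nestedBracket l)
  | [] => by simp [nestedBracket, h0]
  | [a] => by simp [nestedBracket]
  | a :: b :: l => by
    have := nestedBracket_map f h0 hf (b :: l)
    simp only [List.map_cons] at this
    simp [nestedBracket, hf, this]

theorem nestedBracket_eq_zero_of_mem :
    ∀ l : List 𝔤, (0 : 𝔤) ∈ l → nestedBracket l = 0
  | [], h => by simp at h
  | [a], h => by simpa [nestedBracket, eq_comm] using h
  | a :: b :: l, h => by
    rcases List.mem_cons.1 h with h | h
    · simp [nestedBracket, ← h]
    · simp [nestedBracket, nestedBracket_eq_zero_of_mem (b :: l) h]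

theorem nestedBracket_replicate (X : 𝔤) :
    ∀ n : ℕ, nestedBracket (List.replicate (n + 2) X) = 0
  | 0 => by simp [nestedBracket]
  | n + 1 => by
    have := nestedBracket_replicate X n
    simp only [List.replicate_succ] at this ⊢
    rw [nestedBracket, this, lie_zero]

variable [LieAlgebra ℝ 𝔤] [LieAlgebra ℝ 𝔥]

/-- Every term is an iterated bracket. Applied to dilations, this makes them endomorphisms of the
group law. -/
theorem bch_map (r : ℕ) (f : 𝔤 →ₗ[ℝ] 𝔥) (hf : ∀ x y, f ⁅x, y⁆ = ⁅f x, f y⁆) (X Y : 𝔤) :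
    bch r (f X) (f Y) = f (bch r X Y) := by
  simp only [bch, map_sum, map_smul, dynkinWord_map, nestedBracket_map f (map_zero f) hf]

/-- A word containing the letter `0` has zero bracket, and so has `X…X` of length at least two. Only
the one-letter word `X` survives, from the single block `(1, 0)`. -/
theorem bch_zero_right {r : ℕ} (hr : 0 < r) (X : 𝔤) : bch r X 0 = X := by
  have hword : ∀ (k : ℕ) (e : Fin k → ℕ × ℕ), e ∈ dynkinIndex r k →
      nestedBracket (dynkinWord e X 0) ≠ 0 →
      (∀ i, (e i).2 = 0) ∧ ∑ i, ((e i).1 + (e i).2) = 1 := by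
    intro k e he hne
    have h2 : ∀ i, (e i).2 = 0 := by
      intro i
      by_contra hi
      exact hne (nestedBracket_eq_zero_of_mem _ (mem_dynkinWord_right e X 0 i hi))
    refine ⟨h2, ?_⟩
    have hrep : dynkinWord e X 0 = List.replicate (∑ i, ((e i).1 + (e i).2)) X := by
      rw [← length_dynkinWord e X 0]
      refine List.eq_replicate_of_mem fun a ha => ?_
      simp only [dynkinWord, List.mem_flatten, List.mem_ofFn] at ha
      obtain ⟨l, ⟨i, rfl⟩, hl⟩ := ha
      simp only [List.mem_append, List.mem_replicate, h2] at hl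
      tauto
    rw [hrep] at hne
    generalize ∑ i, ((e i).1 + (e i).2) = n at hne
    match n with
    | 0 => simp [nestedBracket] at hne
    | 1 => rfl
    | n + 2 => exact absurd (nestedBracket_replicate X n) hne
  have hk : ∀ k ∈ Finset.Icc 1 r, k ≠ 1 → ((-1 : ℝ) ^ (k - 1) / (k : ℝ)) •
    ∑ e ∈ dynkinIndex r k,
      (((∑ i, ((e i).1 + (e i).2) : ℕ) : ℝ) *
        ∏ i, (((e i).1 ! : ℝ) * ((e i).2 ! : ℝ)))⁻¹ • nestedBracket (dynkinWord e X 0) = 0 := by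
    intro k hk hk1
    rw [Finset.sum_eq_zero, smul_zero]
    intro e he
    by_contra hne
    have hne' : nestedBracket (dynkinWord e X 0) ≠ 0 := fun h => hne (by rw [h, smul_zero])
    obtain ⟨-, hs⟩ := hword k e he hne'
    have hpos : ∀ i, 1 ≤ (e i).1 + (e i).2 := (Finset.mem_filter.1 he).2.1
    have : ∑ i : Fin k, 1 ≤ ∑ i, ((e i).1 + (e i).2) := Finset.sum_le_sum fun i _ => hpos i
    simp only [Finset.sum_const, Finset.card_univ, Fintype.card_fin, smul_eq_mul, mul_one] at this
    have := (Finset.mem_Icc.1 hk).1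
    omega
  rw [bch, Finset.sum_eq_single 1 hk (by simp; omega),
    Finset.sum_eq_single (fun _ => (1, 0))]
  · simp [dynkinWord, nestedBracket]
  · intro e he hne
    by_contra hc
    have hne' : nestedBracket (dynkinWord e X 0) ≠ 0 := fun h => hc (by rw [h, smul_zero])
    obtain ⟨h2, hs⟩ := hword 1 e he hne'
    apply hne
    ext i
    · have := h2 i
      simp only [Fin.sum_univ_one] at hs
      obtain rfl : i = 0 := Subsingleton.elim _ _
      simp; omega
    · simp [h2 i]
  · intro h
    exfalso
    apply h
    simp [dynkinIndex]
    omega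

end BCHLemmas

/-! ### The grading and the dilations of the Lie algebra. -/

namespace Stratification

variable {𝔤 : Type*} [LieRing 𝔤] [LieAlgebra ℝ 𝔤] {r : ℕ} (S : Stratification 𝔤 r)

/-- The strata, continued by `0` beyond the step. -/
def layer (i : ℕ) : Submodule ℝ 𝔤 := if i ≤ r then S.V i else ⊥

theorem layer_of_le {i : ℕ} (h : i ≤ r) : S.layer i = S.V i := if_pos h

theorem layer_of_lt {i : ℕ} (h : r < i) : S.layer i = ⊥ := if_neg (by omega)

theorem lie_mem_layer_one {j : ℕ} (hj : 1 ≤ j) {x y : 𝔤} (hx : x ∈ S.layer 1)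
    (hy : y ∈ S.layer j) : ⁅x, y⁆ ∈ S.layer (1 + j) := by
  have hr := S.pos
  rw [S.layer_of_le hr] at hx
  rcases lt_trichotomy j r with h | h | h
  · rw [S.layer_of_le h.le] at hy
    rw [add_comm, S.layer_of_le (by omega), ← S.bracket_eq j hj h]
    exact Submodule.subset_span ⟨x, hx, y, hy, rfl⟩
  · subst h
    rw [S.layer_of_le le_rfl] at hy
    rw [S.bracket_last x hx y hy]
    exact zero_mem _
  · rw [S.layer_of_lt h, Submodule.mem_bot] at hy
    simp [hy]

/-- Induction on `i`: `V (i+1)` is spanned by brackets `[a, c]` with `a` horizontal, and Jacobi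
gives `[[a,c],y] = [a,[c,y]] - [c,[a,y]]`. -/
theorem lie_mem_layer (i : ℕ) (hi : 1 ≤ i) : ∀ j, 1 ≤ j → ∀ x ∈ S.layer i, ∀ y ∈ S.layer j,
    ⁅x, y⁆ ∈ S.layer (i + j) := by
  induction i, hi using Nat.le_induction with
  | base => exact fun j hj x hx y hy => S.lie_mem_layer_one hj hx hy
  | succ i hi ih =>
    intro j hj x hx y hy
    by_cases h : i + 1 ≤ r
    · rw [S.layer_of_le h, ← S.bracket_eq i hi (by omega)] at hx
      induction hx using Submodule.span_induction with
      | mem z hz =>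
        obtain ⟨a, ha, c, hc, rfl⟩ := hz
        rw [← S.layer_of_le S.pos] at ha
        rw [← S.layer_of_le (by omega)] at hc
        rw [lie_lie]
        refine sub_mem ?_ ?_
        · have := S.lie_mem_layer_one (by omega) ha (ih j hj c hc y hy)
          rwa [show i + 1 + j = 1 + (i + j) by ring]
        · have := ih (1 + j) (by omega) c hc _ (S.lie_mem_layer_one hj ha hy)
          rwa [show i + 1 + j = i + (1 + j) by ring]
      | zero => simp
      | add a c _ _ ha hc => rw [add_lie]; exact add_mem ha hc
      | smul t a _ ha => rw [smul_lie]; exact Submodule.smul_mem _ _ ha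
    · rw [S.layer_of_lt (by omega), Submodule.mem_bot] at hx
      simp [hx]

namespace AdaptedBasis

variable {S} (b : S.AdaptedBasis)

theorem span_eq (i : Fin r) :
    Submodule.span ℝ (Set.range fun j => b.basis ⟨i, j⟩) = S.V (i + 1) := by
  have : FiniteDimensional ℝ 𝔤 := b.basis.finiteDimensional_of_finite
  refine Submodule.eq_of_le_of_finrank_eq ?_ ?_
  · rw [Submodule.span_le]
    rintro _ ⟨j, rfl⟩
    exact b.mem i j
  · have hli : LinearIndependent ℝ fun j => b.basis ⟨i, j⟩ :=
      b.basis.linearIndependent.comp (fun j => (⟨i, j⟩ : Σ i : Fin r, Fin (S.dim i)))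
        (fun _ _ h => by simpa using h)
    rw [finrank_span_eq_card hli, Fintype.card_fin]
    rfl

/-- The dilation of `𝔤` that multiplies the stratum `V i` by `c ^ i`. -/
noncomputable def dilation (c : ℝ) : 𝔤 →ₗ[ℝ] 𝔤 :=
  b.basis.constr ℝ fun ij => c ^ ((ij.1 : ℕ) + 1) • b.basis ij

theorem dilation_basis (c : ℝ) (ij : Σ i : Fin r, Fin (S.dim i)) :
    b.dilation c (b.basis ij) = c ^ ((ij.1 : ℕ) + 1) • b.basis ij := by
  simp [dilation]

theorem dilation_of_mem_layer (c : ℝ) {i : ℕ} (hi : 1 ≤ i) {x : 𝔤} (hx : x ∈ S.layer i) :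
    b.dilation c x = c ^ i • x := by
  by_cases h : i ≤ r
  · obtain ⟨k, rfl⟩ : ∃ k, i = k + 1 := ⟨i - 1, by omega⟩
    rw [S.layer_of_le h] at hx
    have hs := b.span_eq ⟨k, by omega⟩
    simp only at hs
    rw [← hs] at hx
    induction hx using Submodule.span_induction with
    | mem z hz => obtain ⟨j, rfl⟩ := hz; exact b.dilation_basis c _
    | zero => simp
    | add a d _ _ ha hd => rw [map_add, ha, hd, smul_add]
    | smul t a _ ha => rw [map_smul, ha, smul_comm]
  · rw [S.layer_of_lt (by omega), Submodule.mem_bot] at hx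
    simp [hx]

theorem basis_mem_layer (ij : Σ i : Fin r, Fin (S.dim i)) :
    b.basis ij ∈ S.layer ((ij.1 : ℕ) + 1) := by
  rw [S.layer_of_le (by omega)]
  exact b.mem ij.1 ij.2

/-- Both sides are bilinear, so basis vectors suffice; there `[Vᵢ, Vⱼ] ⊆ Vᵢ₊ⱼ` and `cⁱ cʲ = cⁱ⁺ʲ`.
-/
theorem dilation_lie (c : ℝ) (x y : 𝔤) :
    b.dilation c ⁅x, y⁆ = ⁅b.dilation c x, b.dilation c y⁆ := by
  let B₁ : 𝔤 →ₗ[ℝ] 𝔤 →ₗ[ℝ] 𝔤 := (LieModule.toEnd ℝ 𝔤 𝔤 : 𝔤 →ₗ[ℝ] Module.End ℝ 𝔤)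
  suffices B₁.compr₂ (b.dilation c) = B₁.compl₁₂ (b.dilation c) (b.dilation c) by
    have := LinearMap.congr_fun₂ this x y
    simpa [B₁] using this
  refine LinearMap.ext_basis b.basis b.basis fun i j => ?_
  have h := S.lie_mem_layer _ (by omega) _ (by omega) _ (b.basis_mem_layer i) _
    (b.basis_mem_layer j)
  simp only [B₁, LinearMap.compr₂_apply, LinearMap.compl₁₂_apply, LieHom.coe_toLinearMap,
    LieModule.toEnd_apply_apply, dilation_basis, b.dilation_of_mem_layer c (by omega) h, smul_lie,
    lie_smul, smul_smul]
  rw [pow_add, mul_comm]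

end AdaptedBasis

end Stratification

end Carnot

/-! ### The homogeneous gauge, its balls and the coordinate dilations. -/

noncomputable section

namespace Carnot

namespace Stratification

variable {𝔤 : Type*} [LieRing 𝔤] [LieAlgebra ℝ 𝔤] {r : ℕ} (S : Stratification 𝔤 r)

/-- The dilation with factor `c` in exponential coordinates. -/
def dil (c : ℝ) (x : S.Point) : S.Point := fun ij => c ^ ((ij.1 : ℕ) + 1) * x ij

/-- The degree `2 r!` of the polynomial gauge. -/
def gaugeDegree (_ : Stratification 𝔤 r) : ℕ := 2 * r !

/-- The polynomial `|x| ^ (2 r!)`, where `|x|` is the homogeneous norm. -/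
def gauge (x : S.Point) : ℝ := ∑ i : Fin r, (∑ j, x ⟨i, j⟩ ^ 2) ^ (r ! / ((i : ℕ) + 1))

theorem two_le_gaugeDegree : 2 ≤ S.gaugeDegree := by
  have := Nat.factorial_pos r
  unfold gaugeDegree
  omega

theorem even_gaugeDegree : Even S.gaugeDegree := even_two_mul _

theorem div_mul_cancel_factorial (i : Fin r) : r ! / ((i : ℕ) + 1) * ((i : ℕ) + 1) = r ! :=
  Nat.div_mul_cancel (Nat.dvd_factorial (by omega) (by omega))

theorem gauge_nonneg (x : S.Point) : 0 ≤ S.gauge x := by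
  unfold gauge
  positivity

theorem gauge_dil (c : ℝ) (x : S.Point) : S.gauge (S.dil c x) = c ^ S.gaugeDegree * S.gauge x := by
  simp only [gauge, dil, Finset.mul_sum]
  refine Finset.sum_congr rfl fun i _ => ?_
  simp only [mul_pow, ← Finset.mul_sum]
  rw [gaugeDegree]
  congr 1
  conv_rhs => rw [← div_mul_cancel_factorial i]
  ring

theorem homNorm_eq (x : S.Point) :
    S.homNorm x = S.gauge x ^ ((1 : ℝ) / (S.gaugeDegree : ℝ)) := by
  unfold homNorm gauge gaugeDegree
  congr 1
  refine Finset.sum_congr rfl fun i _ => ?_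
  rw [Nat.mul_div_assoc _ (Nat.dvd_factorial (by omega) (by omega)), pow_mul,
    Real.sq_sqrt (by positivity)]

theorem mem_ball_iff {R : ℝ} (hR : 0 < R) (x : S.Point) :
    x ∈ S.ball R ↔ S.gauge x < R ^ S.gaugeDegree := by
  have h2 := S.two_le_gaugeDegree
  rw [ball, mem_ofPred_eq, homNorm_eq, one_div,
    Real.rpow_inv_lt_iff_of_pos (S.gauge_nonneg x) hR.le (by positivity), Real.rpow_natCast]

theorem contDiff_gauge : ContDiff ℝ ∞ S.gauge := by
  unfold gauge
  fun_prop

/-- The space-time gauge `t ^ (2 r!) + |x| ^ (2 r!)`. -/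
def stGauge (z : ℝ × S.Point) : ℝ := z.1 ^ S.gaugeDegree + S.gauge z.2

theorem stGauge_nonneg (z : ℝ × S.Point) : 0 ≤ S.stGauge z :=
  add_nonneg (S.even_gaugeDegree.pow_nonneg _) (S.gauge_nonneg _)

theorem contDiff_stGauge : ContDiff ℝ ∞ S.stGauge :=
  (contDiff_fst.pow _).add (S.contDiff_gauge.comp contDiff_snd)

/-- The anisotropic box that contains the gauge ball of radius `ρ`. -/
def box (ρ : ℝ) : Set (ℝ × S.Point) :=
  Icc (-ρ) ρ ×ˢ Icc (fun ij => -ρ ^ ((ij.1 : ℕ) + 1)) (fun ij => ρ ^ ((ij.1 : ℕ) + 1))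

theorem abs_coord_le {ρ : ℝ} (hρ : 0 ≤ ρ) {x : S.Point} (hx : S.gauge x ≤ ρ ^ S.gaugeDegree)
    (ij : Σ i : Fin r, Fin (S.dim i)) : |x ij| ≤ ρ ^ ((ij.1 : ℕ) + 1) := by
  obtain ⟨i, j⟩ := ij
  have h1 : x ⟨i, j⟩ ^ 2 ≤ ∑ j, x ⟨i, j⟩ ^ 2 :=
    Finset.single_le_sum (f := fun j => x ⟨i, j⟩ ^ 2) (fun _ _ => sq_nonneg _) (Finset.mem_univ j)
  have h2 : (∑ j, x ⟨i, j⟩ ^ 2) ^ (r ! / ((i : ℕ) + 1)) ≤ S.gauge x :=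
    Finset.single_le_sum (f := fun i : Fin r => (∑ j, x ⟨i, j⟩ ^ 2) ^ (r ! / ((i : ℕ) + 1)))
      (fun _ _ => by positivity) (Finset.mem_univ i)
  have h3 : (x ⟨i, j⟩ ^ 2) ^ (r ! / ((i : ℕ) + 1)) ≤
      ((ρ ^ ((i : ℕ) + 1)) ^ 2) ^ (r ! / ((i : ℕ) + 1)) := by
    calc _ ≤ _ := pow_le_pow_left₀ (sq_nonneg _) h1 _
      _ ≤ _ := h2.trans hx
      _ = _ := by
        rw [gaugeDegree]
        conv_lhs => rw [← div_mul_cancel_factorial i]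
        ring
  have h0 : r ! / ((i : ℕ) + 1) ≠ 0 := by
    intro h
    have := div_mul_cancel_factorial i
    rw [h, zero_mul] at this
    exact (Nat.factorial_pos r).ne this
  exact abs_le_of_sq_le_sq (le_of_pow_le_pow_left₀ h0 (by positivity) h3) (by positivity)

theorem mem_box_of_stGauge_le {ρ : ℝ} (hρ : 0 ≤ ρ) {z : ℝ × S.Point}
    (hz : S.stGauge z ≤ ρ ^ S.gaugeDegree) : z ∈ S.box ρ := by
  have h0 := S.gauge_nonneg z.2
  have h0' : 0 ≤ z.1 ^ S.gaugeDegree := S.even_gaugeDegree.pow_nonneg _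
  have h2 := S.two_le_gaugeDegree
  unfold stGauge at hz
  refine ⟨abs_le.1 ?_, ?_, ?_⟩
  · refine le_of_pow_le_pow_left₀ (n := S.gaugeDegree) (by omega) hρ ?_
    rw [S.even_gaugeDegree.pow_abs]
    linarith
  · intro ij
    exact (abs_le.1 (S.abs_coord_le hρ (by linarith) ij)).1
  · intro ij
    exact (abs_le.1 (S.abs_coord_le hρ (by linarith) ij)).2

theorem isCompact_box (ρ : ℝ) : IsCompact (S.box ρ) := isCompact_Icc.prod isCompact_Icc

/-- The weights of the space coordinates add up to `Q` and time has weight `1`; this is where the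
exponent `Q + 1` enters. -/
theorem volume_box {ρ : ℝ} (hρ : 0 ≤ ρ) : volume.real (S.box ρ) =
    2 ^ (Fintype.card (Σ i : Fin r, Fin (S.dim i)) + 1) * ρ ^ (S.homDim + 1) := by
  have h : ∏ ij : (Σ i : Fin r, Fin (S.dim i)), ρ ^ ((ij.1 : ℕ) + 1) = ρ ^ S.homDim := by
    rw [Finset.prod_pow_eq_pow_sum, Fintype.sum_sigma]
    congr 1
    refine Finset.sum_congr rfl fun i _ => ?_
    simp [mul_comm]
  rw [box, Measure.volume_eq_prod, measureReal_def, Measure.prod_prod, ENNReal.toReal_mul,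
    Real.volume_Icc, Real.volume_Icc_pi_toReal, ENNReal.toReal_ofReal (by linarith)]
  · simp only [sub_neg_eq_add, ← two_mul, Finset.prod_mul_distrib, h]
    simp
    ring
  · intro ij
    have : 0 ≤ ρ ^ ((ij.1 : ℕ) + 1) := by positivity
    simp only
    linarith

theorem isCompact_stGauge_le (ρ : ℝ) (hρ : 0 ≤ ρ) :
    IsCompact {z | S.stGauge z ≤ ρ ^ S.gaugeDegree} :=
  (S.isCompact_box ρ).of_isClosed_subset
    (isClosed_le S.contDiff_stGauge.continuous continuous_const)
    fun _ hz => S.mem_box_of_stGauge_le hρ hz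

/-- The space-time dilation. -/
def stDil (c : ℝ) (z : ℝ × S.Point) : ℝ × S.Point := (c * z.1, S.dil c z.2)

theorem stGauge_stDil (c : ℝ) (z : ℝ × S.Point) :
    S.stGauge (S.stDil c z) = c ^ S.gaugeDegree * S.stGauge z := by
  simp only [stGauge, stDil, gauge_dil]
  ring

theorem dil_dil (c d : ℝ) (x : S.Point) : S.dil c (S.dil d x) = S.dil (c * d) x := by
  ext ij
  simp only [dil]
  ring

theorem dil_one (x : S.Point) : S.dil 1 x = x := by
  ext ij
  simp [dil]

theorem stDil_stDil (c d : ℝ) (z : ℝ × S.Point) :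
    S.stDil c (S.stDil d z) = S.stDil (c * d) z := by
  simp [stDil, dil_dil, mul_assoc]

theorem stDil_one (z : ℝ × S.Point) : S.stDil 1 z = z := by
  simp [stDil, dil_one]

/-- A continuous homogeneous function of degree `d` is bounded by a multiple of the `d`-th power
of the homogeneous space-time norm. -/
theorem exists_bound_of_homogeneous (d : ℕ) (f : ℝ × S.Point → ℝ) (hf : Continuous f)
    (hhom : ∀ c : ℝ, 0 < c → ∀ z, f (S.stDil c z) = c ^ d * f z) :
    ∃ C : ℝ, 0 ≤ C ∧ ∀ ρ : ℝ, 0 < ρ → ∀ z, S.stGauge z = ρ ^ S.gaugeDegree →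
      |f z| ≤ C * ρ ^ d := by
  obtain ⟨C, hC⟩ := (S.isCompact_stGauge_le 1 zero_le_one).exists_bound_of_continuousOn
    hf.continuousOn
  refine ⟨max C 0, le_max_right _ _, fun ρ hρ z hz => ?_⟩
  set y := S.stDil ρ⁻¹ z with hy
  have hzy : z = S.stDil ρ y := by
    rw [hy, stDil_stDil, mul_inv_cancel₀ hρ.ne', stDil_one]
  have hy1 : S.stGauge y ≤ 1 ^ S.gaugeDegree := by
    rw [hy, stGauge_stDil, hz, inv_pow, one_pow, inv_mul_cancel₀ (by positivity)]
  have := hC y hy1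
  rw [hzy, hhom ρ hρ, abs_mul, abs_of_pos (pow_pos hρ d), mul_comm]
  gcongr
  exact this.trans (le_max_left _ _)

/-! ### Smoothness of the group law, horizontal fields, and the wave operator on functions of the
gauge. -/

namespace AdaptedBasis

variable {S} (b : S.AdaptedBasis)

theorem equivFun_symm_dil (c : ℝ) (x : S.Point) :
    b.basis.equivFun.symm (S.dil c x) = b.dilation c (b.basis.equivFun.symm x) := by
  simp only [Module.Basis.equivFun_symm_apply, map_sum, map_smul, dilation_basis, dil, smul_smul]
  simp only [mul_comm]

theorem mul_dil (c : ℝ) (x y : S.Point) :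
    b.mul (S.dil c x) (S.dil c y) = S.dil c (b.mul x y) := by
  rw [mul, equivFun_symm_dil, equivFun_symm_dil, bch_map r _ (b.dilation_lie c), mul]
  apply b.basis.equivFun.symm.injective
  rw [equivFun_symm_dil]
  simp

theorem mul_point_zero (x : S.Point) : b.mul x 0 = x := by
  rw [mul, map_zero, bch_zero_right S.pos, LinearEquiv.apply_symm_apply]

/-- The bracket is polynomial in coordinates. Smoothness is stated through `equivFun` since `𝔤`
carries no norm. -/
theorem contDiff_lie {E : Type*} [NormedAddCommGroup E] [NormedSpace ℝ E] {f g : E → 𝔤}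
    (hf : ContDiff ℝ ∞ fun e => b.basis.equivFun (f e))
    (hg : ContDiff ℝ ∞ fun e => b.basis.equivFun (g e)) :
    ContDiff ℝ ∞ fun e => b.basis.equivFun ⁅f e, g e⁆ := by
  have h : ∀ x y : 𝔤, b.basis.equivFun ⁅x, y⁆ = ∑ i, ∑ j,
      (b.basis.equivFun x i * b.basis.equivFun y j) •
        b.basis.equivFun ⁅b.basis i, b.basis j⁆ := by
    intro x y
    conv_lhs => rw [← b.basis.sum_equivFun x, ← b.basis.sum_equivFun y]
    simp only [sum_lie, lie_sum, smul_lie, lie_smul, map_sum, map_smul, Finset.smul_sum,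
      smul_smul]
    rw [Finset.sum_comm]
    simp only [mul_comm]
  rw [show (fun e => b.basis.equivFun ⁅f e, g e⁆) = _ from funext fun e => h (f e) (g e)]
  refine ContDiff.sum fun i _ => ContDiff.sum fun j _ => ContDiff.smul_const ?_ _
  exact (contDiff_pi.1 hf i).mul (contDiff_pi.1 hg j)

theorem contDiff_nestedBracket {ι E : Type*} [NormedAddCommGroup E] [NormedSpace ℝ E]
    (f : ι → E → 𝔤) (hf : ∀ i, ContDiff ℝ ∞ fun e => b.basis.equivFun (f i e)) :
    ∀ l : List ι, ContDiff ℝ ∞ fun e => b.basis.equivFun (nestedBracket (l.map fun i => f i e))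
  | [] => by simpa [nestedBracket] using contDiff_const
  | [i] => hf i
  | i :: j :: l => b.contDiff_lie (hf i) (contDiff_nestedBracket f hf (j :: l))

theorem contDiff_mul {E : Type*} [NormedAddCommGroup E] [NormedSpace ℝ E] {f g : E → S.Point}
    (hf : ContDiff ℝ ∞ f) (hg : ContDiff ℝ ∞ g) :
    ContDiff ℝ ∞ fun e => b.mul (f e) (g e) := by
  simp only [mul, bch, map_sum, map_smul]
  refine ContDiff.sum fun k _ => ContDiff.const_smul _ (ContDiff.sum fun e _ =>
    ContDiff.const_smul _ ?_)
  -- Words are written in two abstract letters, so that the list stays fixed while the point varies.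
  let F : Bool → E → 𝔤 := fun c z =>
    b.basis.equivFun.symm (if c then g z else f z)
  have h : ∀ z, dynkinWord e (b.basis.equivFun.symm (f z)) (b.basis.equivFun.symm (g z)) =
      (dynkinWord e false true).map fun c => F c z := fun z =>
    dynkinWord_map e (fun c => F c z) false true
  simp only [h]
  refine b.contDiff_nestedBracket F (fun c => ?_) _
  cases c
  · simpa only [F, LinearEquiv.apply_symm_apply, Bool.false_eq_true, if_false] using hf
  · simpa only [F, LinearEquiv.apply_symm_apply, if_true] using hg

/-- The curve `t ↦ x · exp (t X_k)`. -/
def hcurve (k : Fin (S.dim ⟨0, S.pos⟩)) (x : S.Point) (t : ℝ) : S.Point :=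
  b.mul x (t • Pi.single ⟨⟨0, S.pos⟩, k⟩ 1)

variable (k : Fin (S.dim ⟨0, S.pos⟩))

theorem contDiff_hcurve : ContDiff ℝ ∞ fun z : S.Point × ℝ => b.hcurve k z.1 z.2 :=
  b.contDiff_mul contDiff_fst (contDiff_snd.smul contDiff_const)

theorem hcurve_zero (x : S.Point) : b.hcurve k x 0 = x := by
  simp [hcurve, mul_point_zero]

theorem horizontalField_eq (f : S.Point → ℝ) (x : S.Point) :
    b.horizontalField k f x = deriv (fun t => f (b.hcurve k x t)) 0 := rfl

/-- The dilation is an endomorphism of the product and scales the first layer by `c`. -/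
theorem hcurve_dil (c : ℝ) (x : S.Point) (t : ℝ) :
    b.hcurve k (S.dil c x) (c * t) = S.dil c (b.hcurve k x t) := by
  rw [hcurve, hcurve, ← mul_dil]
  congr 1
  ext ij
  by_cases h : ij = ⟨⟨0, S.pos⟩, k⟩
  · subst h
    simp [dil]
  · simp [dil, Pi.single_eq_of_ne h]

theorem hasDerivAt_comp_hcurve {f : S.Point → ℝ} (hf : ContDiff ℝ ∞ f) (x : S.Point) :
    HasDerivAt (fun t => f (b.hcurve k x t)) (b.horizontalField k f x) 0 := by
  have h : ContDiff ℝ ∞ fun t => f (b.hcurve k x t) :=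
    hf.comp (b.contDiff_mul contDiff_const (contDiff_id.smul contDiff_const))
  exact (h.differentiable (by simp) 0).hasDerivAt

/-- The field is a partial derivative at `t = 0` of a map jointly smooth in `(x, t)`. -/
theorem contDiff_horizontalField {f : S.Point → ℝ} (hf : ContDiff ℝ ∞ f) :
    ContDiff ℝ ∞ (b.horizontalField k f) := by
  let g : S.Point × ℝ → ℝ := fun z => f (b.hcurve k z.1 z.2)
  have hg : ContDiff ℝ ∞ g := hf.comp (b.contDiff_hcurve k)
  have h : b.horizontalField k f = fun x => fderiv ℝ g (x, 0) (0, 1) := by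
    ext x
    have h1 : HasFDerivAt g (fderiv ℝ g (x, 0)) (x, 0) :=
      (hg.differentiable (by simp) _).hasFDerivAt
    have h2 : HasDerivAt (fun t : ℝ => (x, t)) ((0, 1) : S.Point × ℝ) 0 :=
      (hasDerivAt_const 0 x).prodMk (hasDerivAt_id 0)
    exact (h1.comp_hasDerivAt (0 : ℝ) h2).deriv
  rw [h]
  have h3 : ContDiff ℝ ∞ (fderiv ℝ g) := hg.fderiv_right (by simp)
  exact (h3.comp (contDiff_id.prodMk contDiff_const)).clm_apply contDiff_const

theorem horizontalField_homogeneous {f : S.Point → ℝ} {d : ℕ} {c : ℝ} (hc : 0 < c)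
    (hf : ∀ x, f (S.dil c x) = c ^ (d + 1) * f x) (x : S.Point) :
    b.horizontalField k f (S.dil c x) = c ^ d * b.horizontalField k f x := by
  have h : deriv (fun t => f (b.hcurve k (S.dil c x) (c * t))) 0 =
      c * deriv (fun t => f (b.hcurve k (S.dil c x) t)) 0 := by
    have := deriv_comp_mul_left c (fun t => f (b.hcurve k (S.dil c x) t)) 0
    simpa using this
  simp only [hcurve_dil, hf] at h
  rw [deriv_const_mul_field] at h
  rw [horizontalField_eq, horizontalField_eq]
  refine mul_left_cancel₀ hc.ne' ?_
  rw [← h]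
  ring

theorem horizontalField_comp {F : ℝ → ℝ} (hF : ContDiff ℝ ∞ F) {f : S.Point → ℝ}
    (hf : ContDiff ℝ ∞ f) (x : S.Point) :
    b.horizontalField k (fun y => F (f y)) x = deriv F (f x) * b.horizontalField k f x := by
  have h1 := b.hasDerivAt_comp_hcurve k hf x
  have h2 : HasDerivAt F (deriv F (f (b.hcurve k x 0))) (f (b.hcurve k x 0)) :=
    (hF.differentiable (by simp) _).hasDerivAt
  have := (h2.comp (0 : ℝ) h1).deriv
  rw [hcurve_zero] at this
  exact this

theorem horizontalField_mul {f g : S.Point → ℝ} (hf : ContDiff ℝ ∞ f) (hg : ContDiff ℝ ∞ g)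
    (x : S.Point) :
    b.horizontalField k (fun y => f y * g y) x =
      b.horizontalField k f x * g x + f x * b.horizontalField k g x := by
  have := ((b.hasDerivAt_comp_hcurve k hf x).mul (b.hasDerivAt_comp_hcurve k hg x)).deriv
  rw [hcurve_zero] at this
  exact this

theorem horizontalField_horizontalField_comp {F : ℝ → ℝ} (hF : ContDiff ℝ ∞ F)
    {f : S.Point → ℝ} (hf : ContDiff ℝ ∞ f) (x : S.Point) :
    b.horizontalField k (b.horizontalField k fun y => F (f y)) x =
      deriv (deriv F) (f x) * b.horizontalField k f x ^ 2 +
        deriv F (f x) * b.horizontalField k (b.horizontalField k f) x := by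
  have hF' : ContDiff ℝ ∞ (deriv F) := (contDiff_infty_iff_deriv.1 hF).2
  have h : (b.horizontalField k fun y => F (f y)) =
      fun y => deriv F (f y) * b.horizontalField k f y :=
    funext fun y => b.horizontalField_comp k hF hf y
  rw [h, horizontalField_mul b k (f := fun y => deriv F (f y)) (hF'.comp hf) (b.contDiff_horizontalField k hf),
    horizontalField_comp b k hF' hf]
  ring

/-- The square of the length of the space-time gradient of the gauge. -/
def gradSq (z : ℝ × S.Point) : ℝ :=
  (S.gaugeDegree * z.1 ^ (S.gaugeDegree - 1)) ^ 2 + ∑ k, b.horizontalField k S.gauge z.2 ^ 2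

/-- The value of `∂ₜₜ + Δ_𝔾` on the gauge. -/
def boxGauge (z : ℝ × S.Point) : ℝ :=
  S.gaugeDegree * ((S.gaugeDegree - 1 : ℕ) * z.1 ^ (S.gaugeDegree - 2)) +
    b.subLaplacian S.gauge z.2

/-- Chain rule for a second-order operator without zeroth-order term: `F''(N) |∇N|² + F'(N) (∂ₜₜ +
Δ)N`. -/
theorem waveOperator_comp_stGauge {F : ℝ → ℝ} (hF : ContDiff ℝ ∞ F) (z : ℝ × S.Point) :
    iteratedDeriv 2 (fun t : ℝ => F (S.stGauge (t, z.2))) z.1 +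
        b.subLaplacian (fun x => F (S.stGauge (z.1, x))) z.2 =
      deriv (deriv F) (S.stGauge z) * b.gradSq z + deriv F (S.stGauge z) * b.boxGauge z := by
  have hF' : ContDiff ℝ ∞ (deriv F) := (contDiff_infty_iff_deriv.1 hF).2
  have hX : b.subLaplacian (fun x => F (S.stGauge (z.1, x))) z.2 =
      deriv (deriv F) (S.stGauge z) * ∑ k, b.horizontalField k S.gauge z.2 ^ 2 +
        deriv F (S.stGauge z) * b.subLaplacian S.gauge z.2 := by
    let G : ℝ → ℝ := fun s => F (z.1 ^ S.gaugeDegree + s)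
    have hG : ContDiff ℝ ∞ G := hF.comp (contDiff_const.add contDiff_id)
    have h1 : deriv G = fun s => deriv F (z.1 ^ S.gaugeDegree + s) :=
      funext fun s => deriv_comp_const_add _ _ _
    have h2 : deriv (deriv G) = fun s => deriv (deriv F) (z.1 ^ S.gaugeDegree + s) := by
      rw [h1]
      exact funext fun s => deriv_comp_const_add _ _ _
    have h3 := fun k => b.horizontalField_horizontalField_comp k hG S.contDiff_gauge z.2
    rw [h2, h1] at h3
    simp only [subLaplacian, Finset.mul_sum, ← Finset.sum_add_distrib]
    exact Finset.sum_congr rfl fun k _ => h3 k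
  have hpow : ∀ (n : ℕ) (t : ℝ), HasDerivAt (fun t : ℝ => t ^ n) (n * t ^ (n - 1)) t :=
    fun n t => hasDerivAt_pow n t
  have hg : ∀ t, HasDerivAt (fun t : ℝ => S.stGauge (t, z.2))
      (S.gaugeDegree * t ^ (S.gaugeDegree - 1)) t :=
    fun t => (hpow _ t).add_const (S.gauge z.2)
  have hT1 : deriv (fun t : ℝ => F (S.stGauge (t, z.2))) =
      fun t => deriv F (S.stGauge (t, z.2)) * (S.gaugeDegree * t ^ (S.gaugeDegree - 1)) :=
    funext fun t =>
      ((hF.differentiable (by simp) _).hasDerivAt.comp t (hg t)).deriv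
  have hT2 : iteratedDeriv 2 (fun t : ℝ => F (S.stGauge (t, z.2))) z.1 =
      deriv (deriv F) (S.stGauge z) * (S.gaugeDegree * z.1 ^ (S.gaugeDegree - 1)) ^ 2 +
        deriv F (S.stGauge z) *
          (S.gaugeDegree * ((S.gaugeDegree - 1 : ℕ) * z.1 ^ (S.gaugeDegree - 2))) := by
    rw [iteratedDeriv_succ, iteratedDeriv_one, hT1]
    have := ((hF'.differentiable (by simp) _).hasDerivAt.comp z.1 (hg z.1)).mul
      ((hpow (S.gaugeDegree - 1) z.1).const_mul (S.gaugeDegree : ℝ))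
    refine this.deriv.trans ?_
    simp only [Function.comp_apply, Prod.mk.eta, Nat.sub_sub]
    ring
  rw [hX, hT2, gradSq, boxGauge]
  ring

theorem exists_bound_gradSq : ∃ C : ℝ, 0 ≤ C ∧ ∀ ρ : ℝ, 0 < ρ → ∀ z,
    S.stGauge z = ρ ^ S.gaugeDegree → |b.gradSq z| ≤ C * ρ ^ (2 * (S.gaugeDegree - 1)) := by
  have hm := S.two_le_gaugeDegree
  refine S.exists_bound_of_homogeneous _ _ ?_ ?_
  · unfold gradSq
    refine Continuous.add (by fun_prop) (continuous_finsetSum _ fun k _ => ?_)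
    exact ((b.contDiff_horizontalField k S.contDiff_gauge).continuous.comp continuous_snd).pow 2
  · intro c hc z
    have h : ∀ k x, b.horizontalField k S.gauge (S.dil c x) =
        c ^ (S.gaugeDegree - 1) * b.horizontalField k S.gauge x := fun k x =>
      b.horizontalField_homogeneous k hc
        (fun x => by rw [Nat.sub_add_cancel (by omega), gauge_dil]) x
    simp only [gradSq, stDil, h, mul_pow, ← Finset.mul_sum]
    ring

theorem exists_bound_boxGauge : ∃ C : ℝ, 0 ≤ C ∧ ∀ ρ : ℝ, 0 < ρ → ∀ z,
    S.stGauge z = ρ ^ S.gaugeDegree → |b.boxGauge z| ≤ C * ρ ^ (S.gaugeDegree - 2) := by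
  have hm := S.two_le_gaugeDegree
  refine S.exists_bound_of_homogeneous _ _ ?_ ?_
  · unfold boxGauge subLaplacian
    refine Continuous.add (by fun_prop) (continuous_finsetSum _ fun k _ => ?_)
    exact ((b.contDiff_horizontalField k
      (b.contDiff_horizontalField k S.contDiff_gauge)).continuous.comp continuous_snd)
  · intro c hc z
    have h : ∀ k x, b.horizontalField k S.gauge (S.dil c x) =
        c ^ (S.gaugeDegree - 2 + 1) * b.horizontalField k S.gauge x := fun k x =>
      b.horizontalField_homogeneous k hc
        (fun x => by rw [show S.gaugeDegree - 2 + 1 + 1 = S.gaugeDegree by omega, gauge_dil]) x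
    have h' : ∀ k x, b.horizontalField k (b.horizontalField k S.gauge) (S.dil c x) =
        c ^ (S.gaugeDegree - 2) * b.horizontalField k (b.horizontalField k S.gauge) x :=
      fun k x => b.horizontalField_homogeneous k hc (h k) x
    simp only [boxGauge, subLaplacian, stDil, h', mul_pow, ← Finset.mul_sum]
    ring

end AdaptedBasis

end Stratification

end Carnot

end

/-! ### The logarithmic cutoff and its derivative bounds. -/

noncomputable section

namespace Carnot

/-- A smooth step from `1` (on `v ≤ 0`) to `0` (on `v ≥ 1`), raised to the power `ℓ`. -/
def step (ℓ : ℕ) (v : ℝ) : ℝ := Real.smoothTransition (1 - v) ^ ℓ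

theorem contDiff_step (ℓ : ℕ) : ContDiff ℝ ∞ (step ℓ) :=
  (Real.smoothTransition.contDiff.comp (contDiff_const.sub contDiff_id)).pow ℓ

theorem step_of_nonpos (ℓ : ℕ) {v : ℝ} (hv : v ≤ 0) : step ℓ v = 1 := by
  simp [step, Real.smoothTransition.one_of_one_le (show 1 ≤ 1 - v by linarith)]

theorem step_of_one_le {ℓ : ℕ} (hℓ : ℓ ≠ 0) {v : ℝ} (hv : 1 ≤ v) : step ℓ v = 0 := by
  simp [step, Real.smoothTransition.zero_of_nonpos (show 1 - v ≤ 0 by linarith), hℓ]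

theorem step_nonneg (ℓ : ℕ) (v : ℝ) : 0 ≤ step ℓ v := pow_nonneg (Real.smoothTransition.nonneg _) _

theorem step_le_one (ℓ : ℕ) (v : ℝ) : step ℓ v ≤ 1 :=
  pow_le_one₀ (Real.smoothTransition.nonneg _) (Real.smoothTransition.le_one _)

theorem antitone_step (ℓ : ℕ) : Antitone (step ℓ) := fun _ _ h =>
  pow_le_pow_left₀ (Real.smoothTransition.nonneg _)
    (Real.smoothTransition.monotone (by linarith)) _

theorem exists_bound_of_continuous_of_eq_zero {f : ℝ → ℝ} (hf : Continuous f)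
    (h0 : ∀ v < 0, f v = 0) (h1 : ∀ v > 1, f v = 0) : ∃ C, 0 ≤ C ∧ ∀ v, |f v| ≤ C := by
  obtain ⟨C, hC⟩ := (isCompact_Icc (a := (0 : ℝ)) (b := 1)).exists_bound_of_continuousOn
    hf.continuousOn
  refine ⟨max C 0, le_max_right _ _, fun v => ?_⟩
  by_cases hv0 : v < 0
  · simp [h0 v hv0]
  by_cases hv1 : 1 < v
  · simp [h1 v hv1]
  exact (hC v ⟨not_lt.1 hv0, not_lt.1 hv1⟩).trans (le_max_left _ _)

theorem deriv_eq_zero_of_eventually_const {f : ℝ → ℝ} {U : Set ℝ} (hU : IsOpen U) {c : ℝ}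
    (h : ∀ v ∈ U, f v = c) : ∀ v ∈ U, deriv f v = 0 := by
  intro v hv
  have : f =ᶠ[nhds v] fun _ => c := by
    filter_upwards [hU.mem_nhds hv] with w hw using h w hw
  rw [this.deriv_eq, deriv_const]

theorem deriv_step_of_neg (ℓ : ℕ) : ∀ v ∈ Iio (0 : ℝ), deriv (step ℓ) v = 0 :=
  deriv_eq_zero_of_eventually_const isOpen_Iio fun _ hv => step_of_nonpos ℓ (le_of_lt hv)

theorem deriv_deriv_step_of_neg (ℓ : ℕ) : ∀ v ∈ Iio (0 : ℝ), deriv (deriv (step ℓ)) v = 0 :=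
  deriv_eq_zero_of_eventually_const isOpen_Iio (deriv_step_of_neg ℓ)

/-- The first two derivatives of the step are controlled by any root of it of order `p` with
`ℓ / p ≤ ℓ - 2`. -/
theorem exists_bound_deriv_step {ℓ : ℕ} {p : ℝ} (hℓ : 3 ≤ ℓ) (hp : (ℓ : ℝ) / p ≤ ℓ - 2)
    (hp0 : 0 < p) : ∃ C, 0 ≤ C ∧ ∀ v, |deriv (step ℓ) v| ≤ C * step ℓ v ^ (1 / p) ∧
      |deriv (deriv (step ℓ)) v| ≤ C * step ℓ v ^ (1 / p) := by
  let η : ℝ → ℝ := step 1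
  have hη : ContDiff ℝ ∞ η := contDiff_step 1
  have hη' : ContDiff ℝ ∞ (deriv η) := (contDiff_infty_iff_deriv.1 hη).2
  have hη'' : ContDiff ℝ ∞ (deriv (deriv η)) := (contDiff_infty_iff_deriv.1 hη').2
  have hpow : step ℓ = fun v => η v ^ ℓ := by
    ext v
    simp [η, step]
  have h1 : ∀ v ∈ Ioi (1 : ℝ), deriv η v = 0 :=
    deriv_eq_zero_of_eventually_const isOpen_Ioi fun _ hv => step_of_one_le one_ne_zero (le_of_lt hv)
  have h2 : ∀ v ∈ Ioi (1 : ℝ), deriv (deriv η) v = 0 :=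
    deriv_eq_zero_of_eventually_const isOpen_Ioi h1
  obtain ⟨C₁, hC₁, hb₁⟩ := exists_bound_of_continuous_of_eq_zero hη'.continuous
    (deriv_step_of_neg 1) h1
  obtain ⟨C₂, hC₂, hb₂⟩ := exists_bound_of_continuous_of_eq_zero hη''.continuous
    (deriv_deriv_step_of_neg 1) h2
  have hd1 : deriv (step ℓ) = fun v => ℓ * η v ^ (ℓ - 1) * deriv η v := by
    rw [hpow]
    exact funext fun v => ((hη.differentiable (by simp) v).hasDerivAt.pow ℓ).deriv
  have hd2 : ∀ v, deriv (deriv (step ℓ)) v =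
      ℓ * ((ℓ - 1 : ℕ) * η v ^ (ℓ - 2) * deriv η v) * deriv η v +
        ℓ * η v ^ (ℓ - 1) * deriv (deriv η) v := by
    intro v
    rw [hd1]
    have ha := ((hη.differentiable (by simp) v).hasDerivAt.pow (ℓ - 1)).const_mul (ℓ : ℝ)
    have hb := (hη'.differentiable (by simp) v).hasDerivAt
    exact (ha.mul hb).deriv
  have hη0 : ∀ v, 0 ≤ η v := step_nonneg 1
  have hη1 : ∀ v, η v ≤ 1 := step_le_one 1
  -- As `0 ≤ η ≤ 1`, the power `η^(ℓ-2)` left after two differentiations is at most `η^(ℓ/p)`.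
  have hroot : ∀ v, η v ^ (ℓ - 2) ≤ step ℓ v ^ (1 / p) := by
    intro v
    rw [hpow]
    simp only
    rw [← Real.rpow_natCast (η v) ℓ, ← Real.rpow_mul (hη0 v), ← Real.rpow_natCast,
      Nat.cast_sub (by omega)]
    refine Real.rpow_le_rpow_of_exponent_ge' (hη0 v) (hη1 v) (by positivity) ?_
    rw [mul_one_div]
    exact_mod_cast hp
  have hpow1 : ∀ v, η v ^ (ℓ - 1) ≤ η v ^ (ℓ - 2) := fun v =>
    pow_le_pow_of_le_one (hη0 v) (hη1 v) (by omega)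
  have hη2 : ∀ v, 0 ≤ η v ^ (ℓ - 2) := fun v => pow_nonneg (hη0 v) _
  have hη3 : ∀ v, 0 ≤ η v ^ (ℓ - 1) := fun v => pow_nonneg (hη0 v) _
  have hl1 : (0 : ℝ) ≤ (ℓ - 1 : ℕ) := Nat.cast_nonneg _
  refine ⟨ℓ * C₁ + (ℓ * (ℓ - 1 : ℕ) * C₁ * C₁ + ℓ * C₂), by positivity, fun v => ⟨?_, ?_⟩⟩
  · rw [congrFun hd1 v]
    have e0 := hroot v
    have e1 := hpow1 v
    have e2 := hη2 v
    have e3 := hη3 v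
    generalize η v ^ (ℓ - 2) = A at *
    generalize η v ^ (ℓ - 1) = B at *
    calc |(ℓ : ℝ) * B * deriv η v| = ℓ * B * |deriv η v| := by
          rw [abs_mul, abs_of_nonneg (mul_nonneg (Nat.cast_nonneg _) e3)]
      _ ≤ ℓ * A * C₁ := by
          gcongr
          exact hb₁ v
      _ = (ℓ * C₁) * A := by ring
      _ ≤ (ℓ * C₁ + (ℓ * (ℓ - 1 : ℕ) * C₁ * C₁ + ℓ * C₂)) * step ℓ v ^ (1 / p) :=
          mul_le_mul (le_add_of_nonneg_right (by positivity)) e0 e2 (by positivity)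
  · rw [hd2]
    have e0 := hroot v
    have e1 := hpow1 v
    have e2 := hη2 v
    have e3 := hη3 v
    generalize η v ^ (ℓ - 2) = A at *
    generalize η v ^ (ℓ - 1) = B at *
    calc |(ℓ : ℝ) * ((ℓ - 1 : ℕ) * A * deriv η v) * deriv η v + ℓ * B * deriv (deriv η) v|
        ≤ |(ℓ : ℝ) * ((ℓ - 1 : ℕ) * A * deriv η v) * deriv η v| +
          |ℓ * B * deriv (deriv η) v| := abs_add_le _ _
      _ = ℓ * ((ℓ - 1 : ℕ) * A * |deriv η v|) * |deriv η v| + ℓ * B * |deriv (deriv η) v| := by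
          simp only [abs_mul, Nat.abs_cast, abs_of_nonneg e2, abs_of_nonneg e3]
      _ ≤ ℓ * ((ℓ - 1 : ℕ) * A * C₁) * C₁ + ℓ * A * C₂ := by
          gcongr
          · exact hb₁ v
          · exact hb₁ v
          · exact hb₂ v
      _ = (ℓ * (ℓ - 1 : ℕ) * C₁ * C₁ + ℓ * C₂) * A := by ring
      _ ≤ (ℓ * C₁ + (ℓ * (ℓ - 1 : ℕ) * C₁ * C₁ + ℓ * C₂)) * step ℓ v ^ (1 / p) :=
          mul_le_mul (le_add_of_nonneg_left (by positivity)) e0 e2 (by positivity)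

/-- The cutoff in the variable `s = ρ ^ m` that is `1` for `ρ ≤ R` and `0` for `ρ ≥ R * exp L`,
and interpolates on the logarithmic scale. -/
def logCutoff (ℓ m : ℕ) (R L : ℝ) (s : ℝ) : ℝ :=
  step ℓ ((Real.log s / m - Real.log R) / L)

section LogCutoff

variable {ℓ m : ℕ} {R L : ℝ}

/-- `Real.log` is even with `log 0 = 0`, and `R ≥ 1`; hence the cutoff is `1` on a full
neighbourhood of `0`, which makes it smooth on all of `ℝ`. -/
theorem log_lt_of_lt_pow (hm : m ≠ 0) (hR : 1 ≤ R) {s : ℝ} (h : |s| < R ^ m) :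
    (Real.log s / m - Real.log R) ≤ 0 := by
  have hR0 : 0 < R := by linarith
  rw [sub_nonpos, div_le_iff₀ (by positivity), ← Real.log_abs]
  by_cases hs : s = 0
  · have := Real.log_nonneg hR
    simp only [hs, abs_zero, Real.log_zero]
    positivity
  · have := Real.log_le_log (abs_pos.2 hs) h.le
    rw [Real.log_pow] at this
    linarith

theorem logCutoff_of_lt (hm : m ≠ 0) (hR : 1 ≤ R) (hL : 0 < L) {s : ℝ} (h : |s| < R ^ m) :
    logCutoff ℓ m R L s = 1 :=
  step_of_nonpos _ (div_nonpos_of_nonpos_of_nonneg (log_lt_of_lt_pow hm hR h) hL.le)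

theorem logCutoff_of_le (hℓ : ℓ ≠ 0) (hm : m ≠ 0) (hR : 1 ≤ R) (hL : 0 < L) {s : ℝ}
    (h : (R * Real.exp L) ^ m ≤ s) : logCutoff ℓ m R L s = 0 := by
  have hR0 : 0 < R := by linarith
  have := Real.log_le_log (by positivity) h
  rw [Real.log_pow, Real.log_mul hR0.ne' (Real.exp_pos _).ne', Real.log_exp] at this
  refine step_of_one_le hℓ ?_
  rw [le_div_iff₀ hL, one_mul, le_sub_iff_add_le, le_div_iff₀ (by positivity)]
  linarith

theorem logCutoff_nonneg (s : ℝ) : 0 ≤ logCutoff ℓ m R L s := step_nonneg _ _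

theorem logCutoff_le_one (s : ℝ) : logCutoff ℓ m R L s ≤ 1 := step_le_one _ _

theorem contDiff_logCutoff (hm : m ≠ 0) (hR : 1 ≤ R) (hL : 0 < L) :
    ContDiff ℝ ∞ (logCutoff ℓ m R L) := by
  rw [contDiff_iff_contDiffAt]
  intro s
  by_cases hs : s = 0
  · have hR0 : 0 < R := by linarith
    have : logCutoff ℓ m R L =ᶠ[nhds s] fun _ => 1 := by
      have hU : IsOpen {s : ℝ | |s| < R ^ m} := isOpen_lt continuous_abs continuous_const
      filter_upwards [hU.mem_nhds (show |s| < R ^ m by rw [hs, abs_zero]; positivity)] with w hw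
        using logCutoff_of_lt hm hR hL hw
    exact contDiffAt_const.congr_of_eventuallyEq this
  · have h1 : ContDiffAt ℝ ∞ (fun s => (Real.log s / m - Real.log R) / L) s :=
      (((Real.contDiffAt_log.2 hs).div_const _).sub contDiffAt_const).div_const _
    exact (contDiff_step ℓ).contDiffAt.comp s h1

theorem antitoneOn_logCutoff (hm : m ≠ 0) (hR : 1 ≤ R) (hL : 0 < L) :
    AntitoneOn (logCutoff ℓ m R L) (Ici 0) := by
  intro s hs t ht hst
  by_cases h : s = 0
  · have hR0 : 0 < R := by linarith
    rw [h, logCutoff_of_lt (s := 0) hm hR hL (by rw [abs_zero]; positivity)]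
    exact logCutoff_le_one t
  · have hs0 : 0 < s := lt_of_le_of_ne hs (Ne.symm h)
    refine antitone_step ℓ ?_
    gcongr

theorem hasDerivAt_logCutoff_comp {f : ℝ → ℝ} (hf : ContDiff ℝ ∞ f) {s : ℝ} (hs : 0 < s) :
    HasDerivAt (fun s => f ((Real.log s / m - Real.log R) / L))
      (deriv f ((Real.log s / m - Real.log R) / L) * (s⁻¹ / m / L)) s := by
  have h1 : HasDerivAt (fun s => (Real.log s / m - Real.log R) / L) (s⁻¹ / m / L) s :=
    (((Real.hasDerivAt_log hs.ne').div_const _).sub_const _).div_const _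
  exact (hf.differentiable (by simp) _).hasDerivAt.comp s h1

theorem deriv_logCutoff {s : ℝ} (hs : 0 < s) : deriv (logCutoff ℓ m R L) s =
    deriv (step ℓ) ((Real.log s / m - Real.log R) / L) * (s⁻¹ / m / L) :=
  (hasDerivAt_logCutoff_comp (contDiff_step ℓ) hs).deriv

theorem deriv_deriv_logCutoff {s : ℝ} (hs : 0 < s) : deriv (deriv (logCutoff ℓ m R L)) s =
    deriv (deriv (step ℓ)) ((Real.log s / m - Real.log R) / L) * (s⁻¹ / m / L) ^ 2 -
      deriv (step ℓ) ((Real.log s / m - Real.log R) / L) * ((s⁻¹) ^ 2 / m / L) := by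
  have h : deriv (logCutoff ℓ m R L) =ᶠ[nhds s] fun s =>
      deriv (step ℓ) ((Real.log s / m - Real.log R) / L) * (s⁻¹ / m / L) := by
    filter_upwards [isOpen_Ioi.mem_nhds hs] with t ht using deriv_logCutoff ht
  rw [h.deriv_eq]
  have h1 := hasDerivAt_logCutoff_comp (m := m) (R := R) (L := L)
    (contDiff_infty_iff_deriv.1 (contDiff_step ℓ)).2 hs
  have h2 : HasDerivAt (fun s : ℝ => s⁻¹ / m / L) (-(s ^ 2)⁻¹ / m / L) s :=
    ((hasDerivAt_inv hs.ne').div_const _).div_const _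
  refine (h1.mul h2).deriv.trans ?_
  ring

/-- Bounds for the derivatives of the logarithmic cutoff, uniform in `R` and `L ≥ 1`. -/
theorem exists_bound_deriv_logCutoff (hm : m ≠ 0) {p : ℝ} (hℓ : 3 ≤ ℓ)
    (hp : (ℓ : ℝ) / p ≤ ℓ - 2) (hp0 : 0 < p) : ∃ C, 0 ≤ C ∧ ∀ R L : ℝ, 1 ≤ R → 1 ≤ L →
      ∀ s > 0,
        |deriv (logCutoff ℓ m R L) s| ≤ C / L * s⁻¹ * logCutoff ℓ m R L s ^ (1 / p) ∧
        |deriv (deriv (logCutoff ℓ m R L)) s| ≤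
          C / L * (s⁻¹) ^ 2 * logCutoff ℓ m R L s ^ (1 / p) := by
  obtain ⟨C, hC, hb⟩ := exists_bound_deriv_step hℓ hp hp0
  refine ⟨2 * C, by positivity, fun R L hR hL s hs => ?_⟩
  have hL0 : 0 < L := by linarith
  have hm1 : (1 : ℝ) ≤ m := by exact_mod_cast Nat.one_le_iff_ne_zero.2 hm
  obtain ⟨h1, h2⟩ := hb ((Real.log s / m - Real.log R) / L)
  rw [deriv_logCutoff hs, deriv_deriv_logCutoff hs]
  change _ ≤ C * logCutoff ℓ m R L s ^ (1 / p) at h1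
  change _ ≤ C * logCutoff ℓ m R L s ^ (1 / p) at h2
  have hr : 0 ≤ logCutoff ℓ m R L s ^ (1 / p) := Real.rpow_nonneg (logCutoff_nonneg _) _
  generalize logCutoff ℓ m R L s ^ (1 / p) = A at *
  generalize deriv (step ℓ) ((Real.log s / m - Real.log R) / L) = D₁ at *
  generalize deriv (deriv (step ℓ)) ((Real.log s / m - Real.log R) / L) = D₂ at *
  have hs' : 0 < s⁻¹ := inv_pos.2 hs
  generalize s⁻¹ = w at *
  have e1 : |w / m / L| ≤ w / L := by
    rw [abs_of_nonneg (by positivity)]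
    gcongr
    exact div_le_self hs'.le hm1
  -- Here `L ≥ 1` reduces `L⁻²` to `L⁻¹`, the order of the other term.
  have e2 : |(w / m / L) ^ 2| ≤ w ^ 2 / L := by
    rw [abs_pow]
    calc |w / m / L| ^ 2 ≤ (w / L) ^ 2 := by gcongr
      _ = w ^ 2 / L / L := by ring
      _ ≤ w ^ 2 / L := div_le_self (by positivity) hL
  have e3 : |w ^ 2 / m / L| ≤ w ^ 2 / L := by
    rw [abs_of_nonneg (by positivity)]
    gcongr
    exact div_le_self (by positivity) hm1
  constructor
  · rw [abs_mul]
    calc |D₁| * |w / m / L| ≤ (C * A) * (w / L) := by gcongr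
      _ ≤ (C * A) * (w / L) + (C * A) * (w / L) := le_add_of_nonneg_right (by positivity)
      _ = _ := by ring
  · calc |D₂ * (w / m / L) ^ 2 - D₁ * (w ^ 2 / m / L)|
        ≤ |D₂ * (w / m / L) ^ 2| + |D₁ * (w ^ 2 / m / L)| := abs_sub _ _
      _ = |D₂| * |(w / m / L) ^ 2| + |D₁| * |w ^ 2 / m / L| := by rw [abs_mul, abs_mul]
      _ ≤ (C * A) * (w ^ 2 / L) + (C * A) * (w ^ 2 / L) := by gcongr
      _ = _ := by ring

theorem deriv_logCutoff_of_lt (hm : m ≠ 0) (hR : 1 ≤ R) (hL : 0 < L) {s : ℝ}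
    (h : |s| < R ^ m) :
    deriv (logCutoff ℓ m R L) s = 0 ∧ deriv (deriv (logCutoff ℓ m R L)) s = 0 := by
  have hU : IsOpen {s : ℝ | |s| < R ^ m} := isOpen_lt continuous_abs continuous_const
  have h1 := deriv_eq_zero_of_eventually_const hU (f := logCutoff ℓ m R L)
    fun v hv => logCutoff_of_lt hm hR hL hv
  exact ⟨h1 s h, deriv_eq_zero_of_eventually_const hU h1 s h⟩

end LogCutoff

end Carnot

end

/-! ### Layer cake, superlevel sets as balls, and the cutoff bound on exponential shells. -/

noncomputable section

namespace Carnot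

/-- A layer-cake estimate: if the integral of `u` over every superlevel set of a function `f` with
values in `[0, 1]` is at least `c`, so is the integral of `u * f`. -/
theorem le_integral_mul_of_superlevel {X : Type*} [MeasurableSpace X] {μ : Measure X} [SFinite μ]
    {u f : X → ℝ} {A : Set X} {c : ℝ} (hu : IntegrableOn u A μ)
    (hf : Measurable f) (hf0 : ∀ x, 0 ≤ f x) (hf1 : ∀ x, f x ≤ 1) (hfA : ∀ x, x ∉ A → f x = 0)
    (hc : ∀ τ, 0 < τ → τ < 1 → c ≤ ∫ x in {x | τ < f x}, u x ∂μ) :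
    c ≤ ∫ x, u x * f x ∂μ := by
  let ν : Measure ℝ := volume.restrict (Ioo 0 1)
  let E : Set (X × ℝ) := {z | z.2 < f z.1}
  have hE : MeasurableSet E := measurableSet_lt measurable_snd (hf.comp measurable_fst)
  -- Write `f x = ∫₀¹ 1_{τ < f x} dτ` and exchange the integrals.
  let g : X × ℝ → ℝ := E.indicator fun z => u z.1
  have hg : Integrable g ((μ.restrict A).prod ν) :=
    (Integrable.comp_fst hu ν).indicator hE
  have hswap := integral_integral_swap (f := fun x τ => g (x, τ)) hg
  have h1 : ∀ x, ∫ τ, g (x, τ) ∂ν = u x * f x := by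
    intro x
    have : (fun τ => g (x, τ)) = (Iio (f x)).indicator fun _ => u x := rfl
    rw [this, integral_indicator measurableSet_Iio, Measure.restrict_restrict measurableSet_Iio,
      setIntegral_const, Iio_inter_Ioo, measureReal_def, Real.volume_Ioo, min_eq_left (hf1 x),
      sub_zero, ENNReal.toReal_ofReal (hf0 x), smul_eq_mul, mul_comm]
  have h2 : ∀ τ ∈ Ioo (0 : ℝ) 1, ∫ x, g (x, τ) ∂(μ.restrict A) = ∫ x in {x | τ < f x}, u x ∂μ := by
    intro τ hτ
    have hm : MeasurableSet {x | τ < f x} := measurableSet_lt measurable_const hf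
    have : (fun x => g (x, τ)) = {x | τ < f x}.indicator u := rfl
    rw [this, integral_indicator hm, Measure.restrict_restrict hm]
    congr 2
    refine inter_eq_left.2 fun x hx => ?_
    by_contra hxA
    have := hfA x hxA
    have hx' : τ < f x := hx
    have := hτ.1
    linarith
  have h3 : ∫ x, u x * f x ∂μ = ∫ x, ∫ τ, g (x, τ) ∂ν ∂(μ.restrict A) := by
    simp only [h1]
    refine (setIntegral_eq_integral_of_forall_compl_eq_zero fun x hx => ?_).symm
    rw [hfA x hx, mul_zero]
  rw [h3, hswap]
  have h4 : ∫ _ : ℝ, c ∂ν = c := by simp [ν]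
  rw [← h4]
  refine integral_mono_ae (integrable_const c) hg.integral_prod_right ?_
  filter_upwards [ae_restrict_mem measurableSet_Ioo] with τ hτ
  rw [h2 τ hτ]
  exact hc τ hτ.1 hτ.2

theorem exists_exp_shell {R : ℝ} (m : ℕ) {s : ℝ} (n : ℕ) (hn : 1 ≤ n) (h0 : R ^ m ≤ s)
    (h1 : s ≤ (R * Real.exp n) ^ m) : ∃ k < n, (R * Real.exp k) ^ m ≤ s ∧
      s ≤ (R * Real.exp (k + 1)) ^ m := by
  induction n, hn using Nat.le_induction with
  | base => exact ⟨0, one_pos, by simpa using h0, by simpa using h1⟩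
  | succ n hn ih =>
    rcases le_total s ((R * Real.exp n) ^ m) with h | h
    · obtain ⟨k, hk, h⟩ := ih h
      exact ⟨k, by omega, h⟩
    · exact ⟨n, by omega, h, by simpa using h1⟩

namespace Stratification

variable {𝔤 : Type*} [LieRing 𝔤] [LieAlgebra ℝ 𝔤] {r : ℕ} {S : Stratification 𝔤 r}

theorem gaugeDegree_ne_zero (S : Stratification 𝔤 r) : S.gaugeDegree ≠ 0 := by
  have := S.two_le_gaugeDegree
  omega

/-- By monotonicity `{F > τ}` is an interval `[0, s₀)` in the gauge variable, so the radius is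
`s₀^(1/m)`; the plateau `F = 1` forces it to be at least `R`. -/
theorem exists_superlevel_eq_ball {F : ℝ → ℝ} {R b τ : ℝ} (hR : 0 < R) (hF : Continuous F)
    (hanti : AntitoneOn F (Ici 0)) (hF1 : ∀ s, 0 ≤ s → s < R ^ S.gaugeDegree → F s = 1)
    (hb0 : 0 ≤ b) (hb : F b = 0) (hτ0 : 0 < τ) (hτ1 : τ < 1) :
    ∃ ρ, R ≤ ρ ∧ {x | τ < F (S.gauge x)} = S.ball ρ := by
  let A : Set ℝ := Ici 0 ∩ {s | F s ≤ τ}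
  have hA : IsClosed A := isClosed_Ici.inter (isClosed_le hF continuous_const)
  have hne : A.Nonempty := ⟨b, hb0, by rw [mem_ofPred_eq, hb]; exact hτ0.le⟩
  have hbdd : BddBelow A := ⟨0, fun s hs => hs.1⟩
  have hmem : sInf A ∈ A := hA.csInf_mem hne hbdd
  set s₀ := sInf A with hs₀
  have hs0 : 0 ≤ s₀ := hmem.1
  have hFs : F s₀ ≤ τ := hmem.2
  have hlevel : ∀ s, 0 ≤ s → (τ < F s ↔ s < s₀) := by
    intro s hs
    constructor
    · intro h
      by_contra h'
      have := hanti hs0 hs (not_lt.1 h')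
      linarith
    · intro h
      by_contra h'
      have : s₀ ≤ s := csInf_le hbdd ⟨hs, not_lt.1 h'⟩
      linarith
  have hRs : R ^ S.gaugeDegree ≤ s₀ := by
    by_contra h
    have := hF1 s₀ hs0 (not_le.1 h)
    linarith
  have hm := S.gaugeDegree_ne_zero
  have hpow : (s₀ ^ ((S.gaugeDegree : ℝ)⁻¹)) ^ S.gaugeDegree = s₀ := Real.rpow_inv_natCast_pow hs0 hm
  have hRρ : R ≤ s₀ ^ ((S.gaugeDegree : ℝ)⁻¹) := by
    refine le_of_pow_le_pow_left₀ hm (Real.rpow_nonneg hs0 _) ?_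
    rwa [hpow]
  refine ⟨_, hRρ, ?_⟩
  ext x
  rw [S.mem_ball_iff (by linarith), hpow, mem_ofPred_eq, hlevel _ (S.gauge_nonneg x)]

theorem isCompact_gauge_le {ρ : ℝ} (hρ : 0 ≤ ρ) :
    IsCompact {x | S.gauge x ≤ ρ ^ S.gaugeDegree} := by
  refine IsCompact.of_isClosed_subset (isCompact_Icc
    (a := fun ij : (Σ i : Fin r, Fin (S.dim i)) => -ρ ^ ((ij.1 : ℕ) + 1))
    (b := fun ij => ρ ^ ((ij.1 : ℕ) + 1)))
    (isClosed_le S.contDiff_gauge.continuous continuous_const) fun x hx => ⟨?_, ?_⟩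
  · exact fun ij => (abs_le.1 (S.abs_coord_le hρ hx ij)).1
  · exact fun ij => (abs_le.1 (S.abs_coord_le hρ hx ij)).2

/-- If the integrals of `u₁` over all large balls are at least `c`, so is its integral against a
radially decreasing cutoff that is `1` on a large ball. -/
theorem le_integral_mul_logCutoff {ℓ : ℕ} (hℓ : ℓ ≠ 0) {R L c : ℝ} (hR : 1 ≤ R) (hL : 0 < L)
    {u₁ : S.Point → ℝ} (hu₁ : LocallyIntegrable u₁ volume)
    (hc : ∀ ρ, R ≤ ρ → c ≤ ∫ x in S.ball ρ, u₁ x) :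
    c ≤ ∫ x, u₁ x * logCutoff ℓ S.gaugeDegree R L (S.gauge x) := by
  have hm := S.gaugeDegree_ne_zero
  have hR0 : 0 < R := by linarith
  have hF := contDiff_logCutoff (ℓ := ℓ) hm hR hL
  have hK : IsCompact {x | S.gauge x ≤ (R * Real.exp L) ^ S.gaugeDegree} :=
    isCompact_gauge_le (by positivity)
  refine le_integral_mul_of_superlevel (hu₁.integrableOn_isCompact hK)
    (hF.continuous.comp S.contDiff_gauge.continuous).measurable (fun _ => logCutoff_nonneg _)
    (fun _ => logCutoff_le_one _) (fun x hx => ?_) fun τ hτ0 hτ1 => ?_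
  · exact logCutoff_of_le hℓ hm hR hL (not_le.1 hx).le
  · obtain ⟨ρ, hρ, h⟩ := exists_superlevel_eq_ball (S := S) hR0 hF.continuous
      (antitoneOn_logCutoff hm hR hL)
      (fun s hs0 hs => logCutoff_of_lt hm hR hL (by rwa [abs_of_nonneg hs0]))
      (by positivity) (logCutoff_of_le hℓ hm hR hL le_rfl) hτ0 hτ1
    rw [h]
    exact hc ρ hρ

namespace AdaptedBasis

variable (b : S.AdaptedBasis)

/-- The value of `∂ₜₜ + Δ_𝔾` on the space-time cutoff `F ∘ N`. -/
def waveCutoff (F : ℝ → ℝ) (z : ℝ × S.Point) : ℝ :=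
  deriv (deriv F) (S.stGauge z) * b.gradSq z + deriv F (S.stGauge z) * b.boxGauge z

/-- The space-time cutoff `F ∘ N` satisfies
`|(∂ₜₜ + Δ_𝔾) (F ∘ N)| ≤ (C / n) (R exp k)⁻² (F ∘ N)^(1/p)` on the `k`-th shell. -/
theorem exists_bound_waveCutoff {p : ℝ} {ℓ : ℕ} (hℓ : 3 ≤ ℓ)
    (hp : (ℓ : ℝ) / p ≤ ℓ - 2) (hp0 : 0 < p) :
    ∃ C, 0 ≤ C ∧ ∀ R : ℝ, 1 ≤ R → ∀ n : ℕ, 1 ≤ n → ∀ z,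
      b.waveCutoff (logCutoff ℓ S.gaugeDegree R n) z = 0 ∨
      ∃ k < n, S.stGauge z ≤ (R * Real.exp (k + 1)) ^ S.gaugeDegree ∧
        |b.waveCutoff (logCutoff ℓ S.gaugeDegree R n) z| ≤
          C / n * ((R * Real.exp k) ^ 2)⁻¹ *
            logCutoff ℓ S.gaugeDegree R n (S.stGauge z) ^ (1 / p) := by
  have hm := S.gaugeDegree_ne_zero
  have hm2 := S.two_le_gaugeDegree
  obtain ⟨C, hC, hCb⟩ := exists_bound_deriv_logCutoff hm hℓ hp hp0
  obtain ⟨G, hG, hGb⟩ := b.exists_bound_gradSq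
  obtain ⟨H, hH, hHb⟩ := b.exists_bound_boxGauge
  refine ⟨C * (G + H), by positivity, fun R hR n hn z => ?_⟩
  have hn1 : (1 : ℝ) ≤ n := by exact_mod_cast hn
  have hn0 : (0 : ℝ) < n := by linarith
  have hR0 : 0 < R := by linarith
  by_cases hlow : S.stGauge z < R ^ S.gaugeDegree
  · left
    obtain ⟨h1, h2⟩ := deriv_logCutoff_of_lt (ℓ := ℓ) hm hR hn0
      (s := S.stGauge z) (by rwa [abs_of_nonneg (S.stGauge_nonneg z)])
    rw [waveCutoff, h1, h2]
    ring
  have hlow' : R ^ S.gaugeDegree ≤ S.stGauge z := not_lt.1 hlow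
  have hpos : 0 < S.stGauge z := lt_of_lt_of_le (by positivity) hlow'
  obtain ⟨h1, h2⟩ := hCb R n hR hn1 _ hpos
  set ρ := S.stGauge z ^ ((S.gaugeDegree : ℝ)⁻¹) with hρdef
  have hρ0 : 0 < ρ := Real.rpow_pos_of_pos hpos _
  have hρ : S.stGauge z = ρ ^ S.gaugeDegree := (Real.rpow_inv_natCast_pow hpos.le hm).symm
  have h3 := hGb ρ hρ0 z hρ
  have h4 := hHb ρ hρ0 z hρ
  have hA : 0 ≤ logCutoff ℓ S.gaugeDegree R n (S.stGauge z) ^ (1 / p) :=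
    Real.rpow_nonneg (logCutoff_nonneg _) _
  have hmain : |b.waveCutoff (logCutoff ℓ S.gaugeDegree R n) z| ≤
      C * (G + H) / n * (ρ ^ 2)⁻¹ *
        logCutoff ℓ S.gaugeDegree R n (S.stGauge z) ^ (1 / p) := by
    -- Homogeneity count: both terms end up of degree `-2` in `ρ`.
    have e1 : ((S.stGauge z)⁻¹) ^ 2 * ρ ^ (2 * (S.gaugeDegree - 1)) = (ρ ^ 2)⁻¹ := by
      rw [hρ, inv_pow, ← pow_mul]
      rw [inv_mul_eq_iff_eq_mul₀ (by positivity), eq_mul_inv_iff_mul_eq₀ (by positivity),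
        ← pow_add]
      congr 1
      omega
    have e2 : (S.stGauge z)⁻¹ * ρ ^ (S.gaugeDegree - 2) = (ρ ^ 2)⁻¹ := by
      rw [hρ, inv_mul_eq_iff_eq_mul₀ (by positivity), eq_mul_inv_iff_mul_eq₀ (by positivity),
        ← pow_add]
      congr 1
      omega
    generalize logCutoff ℓ S.gaugeDegree R n (S.stGauge z) ^ (1 / p) = A at *
    have hs : 0 < (S.stGauge z)⁻¹ := inv_pos.2 hpos
    calc |b.waveCutoff (logCutoff ℓ S.gaugeDegree R n) z|
        ≤ |deriv (deriv (logCutoff ℓ S.gaugeDegree R n)) (S.stGauge z)| * |b.gradSq z| +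
          |deriv (logCutoff ℓ S.gaugeDegree R n) (S.stGauge z)| * |b.boxGauge z| := by
          rw [waveCutoff, ← abs_mul, ← abs_mul]
          exact abs_add_le _ _
      _ ≤ (C / n * ((S.stGauge z)⁻¹) ^ 2 * A) * (G * ρ ^ (2 * (S.gaugeDegree - 1))) +
          (C / n * (S.stGauge z)⁻¹ * A) * (H * ρ ^ (S.gaugeDegree - 2)) := by
          gcongr
      _ = C / n * A * G * (((S.stGauge z)⁻¹) ^ 2 * ρ ^ (2 * (S.gaugeDegree - 1))) +
          C / n * A * H * ((S.stGauge z)⁻¹ * ρ ^ (S.gaugeDegree - 2)) := by ring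
      _ = _ := by
          rw [e1, e2]
          ring
  -- Beyond the outer radius the cutoff vanishes, so `hmain` itself forces the value `0`.
  by_cases hhigh : (R * Real.exp n) ^ S.gaugeDegree < S.stGauge z
  · left
    have hz : logCutoff ℓ S.gaugeDegree R n (S.stGauge z) = 0 :=
      logCutoff_of_le (by omega) hm hR hn0 hhigh.le
    rw [hz, Real.zero_rpow (by positivity), mul_zero] at hmain
    exact abs_nonpos_iff.1 hmain
  · right
    obtain ⟨k, hk, hk1, hk2⟩ := exists_exp_shell S.gaugeDegree n hn hlow' (not_lt.1 hhigh)
    refine ⟨k, hk, hk2, hmain.trans ?_⟩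
    have hkρ : R * Real.exp k ≤ ρ := by
      refine le_of_pow_le_pow_left₀ hm hρ0.le ?_
      rwa [← hρ]
    have : 0 < R * Real.exp k := by positivity
    gcongr

end AdaptedBasis

end Stratification

end Carnot

end

/-! ### The test-function estimate. -/

noncomputable section

namespace Carnot

namespace Stratification

variable {𝔤 : Type*} [LieRing 𝔤] [LieAlgebra ℝ 𝔤] {r : ℕ} {S : Stratification 𝔤 r}

theorem measurableSet_slab (T : EReal) : MeasurableSet (S.slab T) :=
  (measurableSet_le measurable_const measurable_fst).inter
    (measurableSet_lt (measurable_coe_real_ereal.comp measurable_fst) measurable_const)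

theorem tsupport_logCutoff_subset {ℓ : ℕ} (hℓ : ℓ ≠ 0) {R L : ℝ} (hR : 1 ≤ R) (hL : 0 < L) :
    tsupport (fun z => logCutoff ℓ S.gaugeDegree R L (S.stGauge z)) ⊆
      {z | S.stGauge z ≤ (R * Real.exp L) ^ S.gaugeDegree} := by
  refine closure_minimal (fun z hz => ?_)
    (isClosed_le S.contDiff_stGauge.continuous continuous_const)
  by_contra h
  exact hz (logCutoff_of_le hℓ S.gaugeDegree_ne_zero hR hL (not_le.1 h).le)

theorem isTestFunction_logCutoff {ℓ : ℕ} (hℓ : ℓ ≠ 0) {R L : ℝ} (hR : 1 ≤ R) (hL : 0 < L)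
    {T : EReal} (hT : ((R * Real.exp L : ℝ) : EReal) < T) :
    S.IsTestFunction T fun z => logCutoff ℓ S.gaugeDegree R L (S.stGauge z) where
  contDiff := (contDiff_logCutoff S.gaugeDegree_ne_zero hR hL).comp S.contDiff_stGauge
  hasCompactSupport :=
    (S.isCompact_stGauge_le (R * Real.exp L) (by positivity)).of_isClosed_subset
      (isClosed_tsupport _) (tsupport_logCutoff_subset hℓ hR hL)
  tsupport_subset z hz := by
    have h := S.mem_box_of_stGauge_le (by positivity) (tsupport_logCutoff_subset hℓ hR hL hz)
    exact lt_of_le_of_lt (EReal.coe_le_coe_iff.2 h.1.2) hT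
  nonneg z _ := logCutoff_nonneg _

/-- The piecewise constant majorant of `N ^ (-2q/m)` on the shells of the cutoff. -/
def shellSum (S : Stratification 𝔤 r) (R q : ℝ) (n : ℕ) (z : ℝ × S.Point) : ℝ :=
  ∑ k ∈ Finset.range n,
    -- Full balls replace shells: the overlap only enlarges the majorant, and the volume order is
    -- the same.
    {z | S.stGauge z ≤ (R * Real.exp (k + 1)) ^ S.gaugeDegree}.indicator
      (fun _ => (R * Real.exp k) ^ (-(2 * q))) z

theorem shellSum_nonneg {R : ℝ} (hR : 0 ≤ R) (q : ℝ) (n : ℕ) (z : ℝ × S.Point) :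
    0 ≤ S.shellSum R q n z := by
  refine Finset.sum_nonneg fun k _ => indicator_nonneg (fun _ _ => ?_) _
  positivity

theorem integrable_shellSum_term {R : ℝ} (hR : 0 ≤ R) (c : ℝ) (k : ℕ) :
    Integrable ({z | S.stGauge z ≤ (R * Real.exp (k + 1)) ^ S.gaugeDegree}.indicator
      (fun _ => c)) (volume : Measure (ℝ × S.Point)) := by
  have hK := S.isCompact_stGauge_le (R * Real.exp (k + 1)) (by positivity)
  exact (integrable_indicator_iff hK.measurableSet).2 (integrableOn_const hK.measure_lt_top.ne)

theorem integrable_shellSum {R : ℝ} (hR : 0 ≤ R) (q : ℝ) (n : ℕ) :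
    Integrable (S.shellSum R q n) volume :=
  integrable_finsetSum _ fun k _ => integrable_shellSum_term hR _ k

theorem integral_shellSum_le {R : ℝ} (hR : 0 < R) (q : ℝ) (n : ℕ) :
    ∫ z, S.shellSum R q n z ≤
      2 ^ (Fintype.card (Σ i : Fin r, Fin (S.dim i)) + 1) * Real.exp 1 ^ (S.homDim + 1) *
        ∑ k ∈ Finset.range n, (R * Real.exp k) ^ ((S.homDim : ℝ) + 1 - 2 * q) := by
  unfold shellSum
  rw [integral_finsetSum _ fun k _ => integrable_shellSum_term hR.le _ k, Finset.mul_sum]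
  refine Finset.sum_le_sum fun k _ => ?_
  have hρ : 0 ≤ R * Real.exp (k + 1) := by positivity
  have hK := S.isCompact_stGauge_le (R * Real.exp (k + 1)) hρ
  rw [integral_indicator hK.measurableSet, setIntegral_const, smul_eq_mul]
  have hvol : volume.real {z | S.stGauge z ≤ (R * Real.exp (k + 1)) ^ S.gaugeDegree} ≤
      2 ^ (Fintype.card (Σ i : Fin r, Fin (S.dim i)) + 1) *
        (R * Real.exp (k + 1)) ^ (S.homDim + 1) := by
    rw [← S.volume_box hρ]
    exact measureReal_mono (fun z hz => S.mem_box_of_stGauge_le hρ hz)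
      (S.isCompact_box _).measure_lt_top.ne
  have hRk : 0 < R * Real.exp k := by positivity
  calc _ ≤ 2 ^ (Fintype.card (Σ i : Fin r, Fin (S.dim i)) + 1) *
        (R * Real.exp (k + 1)) ^ (S.homDim + 1) * (R * Real.exp k) ^ (-(2 * q)) := by gcongr
    _ = 2 ^ (Fintype.card (Σ i : Fin r, Fin (S.dim i)) + 1) * Real.exp 1 ^ (S.homDim + 1) *
        ((R * Real.exp k) ^ (S.homDim + 1) * (R * Real.exp k) ^ (-(2 * q))) := by
        rw [Real.exp_add]
        ring
    _ = _ := by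
        rw [← Real.rpow_natCast (R * Real.exp k), ← Real.rpow_add hRk]
        push_cast
        rfl

namespace AdaptedBasis

variable (b : S.AdaptedBasis)

/-- The test-function estimate. -/
theorem exists_integral_mul_logCutoff_le {p q : ℝ} (hpq : p.HolderConjugate q) {ℓ : ℕ}
    (hℓ : 3 ≤ ℓ) (hp : (ℓ : ℝ) / p ≤ ℓ - 2) :
    ∃ C, 0 ≤ C ∧ ∀ (R : ℝ) (n : ℕ) (T : EReal), 1 ≤ R → 1 ≤ n →
      ((R * Real.exp n : ℝ) : EReal) < T → ∀ (σ : ℝ) (u₀ u₁ : S.Point → ℝ) (u : ℝ × S.Point → ℝ),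
      b.IsWeakSolution p σ u₀ u₁ T u →
      σ * ∫ x, u₁ x * logCutoff ℓ S.gaugeDegree R n (S.gauge x) ≤
        C * (n : ℝ) ^ (-q) *
          ∑ k ∈ Finset.range n, (R * Real.exp k) ^ ((S.homDim : ℝ) + 1 - 2 * q) := by
  have hp0 : 0 < p := hpq.pos
  have hq0 : 0 < q := hpq.symm.pos
  obtain ⟨C, hC, hb⟩ := b.exists_bound_waveCutoff hℓ hp hp0
  refine ⟨C ^ q * (2 ^ (Fintype.card (Σ i : Fin r, Fin (S.dim i)) + 1) *
    Real.exp 1 ^ (S.homDim + 1)), by positivity, fun R n T hR hn hT σ u₀ u₁ u hu => ?_⟩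
  have hn0 : (0 : ℝ) < n := by exact_mod_cast hn
  have hR0 : 0 < R := by linarith
  have hm := S.gaugeDegree_ne_zero
  have hF : ContDiff ℝ ∞ (logCutoff ℓ S.gaugeDegree R n) := contDiff_logCutoff hm hR hn0
  set F := logCutoff ℓ S.gaugeDegree R n with hFdef
  have htest := isTestFunction_logCutoff (S := S) (ℓ := ℓ) (by omega) hR hn0 hT
  rw [← hFdef] at htest
  have hineq := hu.inequality _ htest
  simp only [waveOperator_comp_stGauge b hF] at hineq
  have h0 : ∀ x, S.stGauge ((0 : ℝ), x) = S.gauge x := fun x => by simp [stGauge, hm]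
  -- `∂ₜ t^m` vanishes at `0` because `m ≥ 2`; this removes `u₀`.
  have hd : ∀ x : S.Point, deriv (fun t : ℝ => F (S.stGauge (t, x))) 0 = 0 := by
    intro x
    have hg : HasDerivAt (fun t : ℝ => S.stGauge (t, x))
        (S.gaugeDegree * (0 : ℝ) ^ (S.gaugeDegree - 1)) 0 :=
      (hasDerivAt_pow S.gaugeDegree (0 : ℝ)).add_const (S.gauge x)
    have h2 := S.two_le_gaugeDegree
    refine ((hF.differentiable (by simp) _).hasDerivAt.comp (0 : ℝ) hg).deriv.trans ?_
    rw [zero_pow (by omega), mul_zero, mul_zero]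
  simp only [h0, hd, mul_zero, integral_zero, sub_zero] at hineq
  have hslab := measurableSet_slab (S := S) T
  -- The cutoff vanishes off a compact part of the slab, where `u` is in `L^p`.
  have hupow : IntegrableOn (fun z => |u z| ^ p * F (S.stGauge z)) (S.slab T) := by
    let K : Set (ℝ × S.Point) :=
      {z | S.stGauge z ≤ (R * Real.exp n) ^ S.gaugeDegree} ∩ {z | 0 ≤ z.1}
    have hK : IsCompact K := (S.isCompact_stGauge_le (R * Real.exp n) (by positivity)).inter_right
      (isClosed_le continuous_const continuous_fst)
    have hKs : K ⊆ S.slab T := fun z hz =>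
      ⟨hz.2, lt_of_le_of_lt (EReal.coe_le_coe_iff.2
        (S.mem_box_of_stGauge_le (by positivity) hz.1).1.2) hT⟩
    have h1 := (hu.memLp_loc K hKs hK).integrable_norm_rpow (by simpa using hp0)
      ENNReal.ofReal_ne_top
    rw [ENNReal.toReal_ofReal hp0.le] at h1
    have h2 : IntegrableOn (fun z => |u z| ^ p * F (S.stGauge z)) K :=
      h1.mul_bdd (c := 1) (hF.continuous.comp S.contDiff_stGauge.continuous).aestronglyMeasurable
        (Eventually.of_forall fun z => by
          rw [Real.norm_eq_abs, abs_of_nonneg (logCutoff_nonneg _)]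
          exact logCutoff_le_one _)
    refine h2.of_forall_sdiff_eq_zero hslab fun z hz => ?_
    have hz' : (R * Real.exp n) ^ S.gaugeDegree < S.stGauge z := by
      by_contra h
      exact hz.2 ⟨not_lt.1 h, hz.1.1⟩
    rw [hFdef, logCutoff_of_le (by omega) hm hR hn0 hz'.le, mul_zero]
  -- Young's inequality with the root `φ^(1/p)` attached to `|u|`; its factors `1/p`, `1/q` are
  -- bounded by `1`.
  have hpt : ∀ z, |u z * b.waveCutoff F z| ≤
      |u z| ^ p * F (S.stGauge z) + (C / n) ^ q * S.shellSum R q n z := by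
    intro z
    have hFz : 0 ≤ F (S.stGauge z) := logCutoff_nonneg _
    have hS := shellSum_nonneg (S := S) hR0.le q n z
    rcases hb R hR n hn z with h | ⟨k, hk, hkz, h⟩
    · rw [h, mul_zero, abs_zero]
      positivity
    · have hRk : 0 < R * Real.exp k := by positivity
      have hterm : (R * Real.exp k) ^ (-(2 * q)) ≤ S.shellSum R q n z := by
        refine le_trans (le_of_eq ?_) (Finset.single_le_sum
          (f := fun k : ℕ => {z | S.stGauge z ≤ (R * Real.exp (k + 1)) ^ S.gaugeDegree}.indicator
            (fun _ => (R * Real.exp k) ^ (-(2 * q))) z)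
          (fun k _ => indicator_nonneg (fun _ _ => by positivity) _) (Finset.mem_range.2 hk))
        exact (indicator_of_mem (s := {z | S.stGauge z ≤ (R * Real.exp (k + 1)) ^ S.gaugeDegree})
          hkz fun _ => (R * Real.exp k) ^ (-(2 * q))).symm
      calc |u z * b.waveCutoff F z| ≤
            |u z| * (C / n * ((R * Real.exp k) ^ 2)⁻¹ * F (S.stGauge z) ^ (1 / p)) := by
            rw [abs_mul]
            gcongr
        _ = (|u z| * F (S.stGauge z) ^ (1 / p)) * (C / n * ((R * Real.exp k) ^ 2)⁻¹) := by ring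
        _ ≤ (|u z| * F (S.stGauge z) ^ (1 / p)) ^ p / p +
            (C / n * ((R * Real.exp k) ^ 2)⁻¹) ^ q / q :=
            Real.young_inequality_of_nonneg (by positivity) (by positivity) hpq
        _ ≤ (|u z| * F (S.stGauge z) ^ (1 / p)) ^ p +
            (C / n * ((R * Real.exp k) ^ 2)⁻¹) ^ q := by
            gcongr
            · exact div_le_self (by positivity) hpq.lt.le
            · exact div_le_self (by positivity) hpq.symm.lt.le
        _ = |u z| ^ p * F (S.stGauge z) + (C / n) ^ q * (R * Real.exp k) ^ (-(2 * q)) := by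
            rw [Real.mul_rpow (abs_nonneg _) (by positivity), ← Real.rpow_mul hFz,
              one_div_mul_cancel hp0.ne', Real.rpow_one,
              Real.mul_rpow (by positivity) (by positivity), Real.inv_rpow (by positivity),
              ← Real.rpow_natCast, ← Real.rpow_mul hRk.le, Real.rpow_neg hRk.le]
            push_cast
            rfl
        _ ≤ _ := by gcongr
  have hsh := integrable_shellSum (S := S) hR0.le q n
  have hdom : |∫ z in S.slab T, u z * b.waveCutoff F z| ≤
      (∫ z in S.slab T, |u z| ^ p * F (S.stGauge z)) +
        (C / n) ^ q * ∫ z, S.shellSum R q n z := by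
    calc |∫ z in S.slab T, u z * b.waveCutoff F z| ≤
          ∫ z in S.slab T, |u z * b.waveCutoff F z| := abs_integral_le_integral_abs
      _ ≤ ∫ z in S.slab T, (|u z| ^ p * F (S.stGauge z) + (C / n) ^ q * S.shellSum R q n z) :=
          integral_mono_of_nonneg (Eventually.of_forall fun _ => abs_nonneg _)
            (hupow.add (hsh.integrableOn.const_mul _)) (Eventually.of_forall hpt)
      _ = (∫ z in S.slab T, |u z| ^ p * F (S.stGauge z)) +
          (C / n) ^ q * ∫ z in S.slab T, S.shellSum R q n z := by
          rw [integral_add hupow (hsh.integrableOn.const_mul _), integral_const_mul]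
      _ ≤ _ := by
          have := setIntegral_le_integral (s := S.slab T) hsh
            (Eventually.of_forall fun z => shellSum_nonneg hR0.le q n z)
          gcongr
  have hfin := integral_shellSum_le (S := S) hR0 q n
  have hle := neg_le_of_abs_le hdom
  have hCn : 0 ≤ (C / n) ^ q := by positivity
  -- The terms `∫ |u|^p φ` of `hineq` and `hle` cancel.
  calc σ * ∫ x, u₁ x * F (S.gauge x) ≤ (C / n) ^ q * ∫ z, S.shellSum R q n z := by
        have : ∫ z in S.slab T, u z * b.waveCutoff F z = ∫ z in S.slab T, u z *
          (deriv (deriv F) (S.stGauge z) * b.gradSq z + deriv F (S.stGauge z) * b.boxGauge z) := rfl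
        linarith
    _ ≤ (C / n) ^ q * _ := mul_le_mul_of_nonneg_left hfin hCn
    _ = _ := by
        rw [Real.div_rpow hC hn0.le, Real.rpow_neg hn0.le]
        ring

end AdaptedBasis

end Stratification

end Carnot

end

/-! ### Solving for the scale, and the lifespan bounds. -/

namespace Carnot

/-- With `R = D σ^(-1/α)` one has `R^(-α) = D^(-α) σ`, so `σ` cancels. -/
theorem le_of_mul_le_rpow_neg {K c σ R α D : ℝ} (hc : 0 < c) (hσ : 0 < σ)
    (hα : 0 < α) (hR : R = D * σ ^ (-α⁻¹)) (hD : 0 < D)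
    (h : σ * c ≤ K * R ^ (-α)) : D ≤ (K / c) ^ α⁻¹ := by
  rw [hR, Real.mul_rpow hD.le (by positivity), ← Real.rpow_mul hσ.le, neg_mul_neg,
    inv_mul_cancel₀ hα.ne', Real.rpow_one] at h
  have hDα : 0 < D ^ α := by positivity
  have h1 : D ^ α ≤ K / c := by
    rw [le_div_iff₀ hc]
    rw [Real.rpow_neg hD.le] at h
    have h2 : σ * (D ^ α * c) ≤ σ * K := by
      calc σ * (D ^ α * c) = D ^ α * (σ * c) := by ring
        _ ≤ D ^ α * (K * ((D ^ α)⁻¹ * σ)) := by gcongr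
        _ = σ * K := by field_simp
    exact le_of_mul_le_mul_left h2 hσ
  calc D = (D ^ α) ^ α⁻¹ := by rw [← Real.rpow_mul hD.le, mul_inv_cancel₀ hα.ne', Real.rpow_one]
    _ ≤ _ := by gcongr

theorem le_of_mul_le_rpow_neg_inv {K c σ β x : ℝ} (hc : 0 < c) (hσ : 0 < σ) (hK : 0 ≤ K)
    (hβ : 0 < β) (hx : 0 < x) (h : σ * c ≤ K * x ^ (-β⁻¹)) :
    x ≤ (K / c) ^ β * σ ^ (-β) := by
  have hxβ : 0 < x ^ β⁻¹ := by positivity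
  have h1 : x ^ β⁻¹ ≤ K / c * σ⁻¹ := by
    rw [← div_eq_mul_inv, div_div, le_div_iff₀ (by positivity)]
    rw [Real.rpow_neg hx.le] at h
    calc x ^ β⁻¹ * (c * σ) = x ^ β⁻¹ * (σ * c) := by ring
      _ ≤ x ^ β⁻¹ * (K * (x ^ β⁻¹)⁻¹) := by gcongr
      _ = K := by field_simp
  calc x = (x ^ β⁻¹) ^ β := by rw [← Real.rpow_mul hx.le, inv_mul_cancel₀ hβ.ne', Real.rpow_one]
    _ ≤ (K / c * σ⁻¹) ^ β := by gcongr
    _ = _ := by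
      rw [Real.mul_rpow (by positivity) (by positivity), Real.inv_rpow hσ.le, Real.rpow_neg hσ.le]

namespace Stratification.AdaptedBasis

variable {𝔤 : Type*} [LieRing 𝔤] [LieAlgebra ℝ 𝔤] {r : ℕ} {S : Stratification 𝔤 r}
  (b : S.AdaptedBasis)

theorem lifespan_le {p σ : ℝ} {u₀ u₁ : S.Point → ℝ} {B : EReal}
    (h : ∀ T, B < T → ∀ u, ¬ b.IsWeakSolution p σ u₀ u₁ T u) : b.lifespan p σ u₀ u₁ ≤ B := by
  refine sSup_le ?_
  rintro T ⟨-, u, hu⟩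
  by_contra hT
  exact h T (not_le.1 hT) u hu

end Stratification.AdaptedBasis

end Carnot

/-- The condition `p ≤ (Q+1)/(Q-1)` is written without the division, so that it reads `p < ∞` in
the case `Q = 1`. -/
theorem theorem1p7 {𝔤 : Type*} [LieRing 𝔤] [LieAlgebra ℝ 𝔤] {r : ℕ}
    (S : Carnot.Stratification 𝔤 r) (b : S.AdaptedBasis) (p : ℝ) (hp : 1 < p)
    (hpQ : p * ((S.homDim : ℝ) - 1) ≤ (S.homDim : ℝ) + 1)
    (u₁ : S.Point → ℝ) (hu₁ : LocallyIntegrable u₁ volume)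
    (hpos : 0 < liminf (fun R : ℝ => ((∫ x in S.ball R, u₁ x : ℝ) : EReal)) atTop) :
    ∃ σ₀ : ℝ, 0 < σ₀ ∧ ∃ C : ℝ, 0 < C ∧
      ∀ u₀ : S.Point → ℝ, LocallyIntegrable u₀ volume → ∀ σ : ℝ, 0 < σ → σ ≤ σ₀ →
        (p * ((S.homDim : ℝ) - 1) < (S.homDim : ℝ) + 1 →
          b.lifespan p σ u₀ u₁ ≤
            ((C * σ ^ (-((p + 1) / (p - 1) - (S.homDim : ℝ))⁻¹) : ℝ) : EReal)) ∧
        (p * ((S.homDim : ℝ) - 1) = (S.homDim : ℝ) + 1 →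
          b.lifespan p σ u₀ u₁ ≤ ((Real.exp (C * σ ^ (-(p - 1))) : ℝ) : EReal)) := by
  obtain ⟨c, hc, hcl⟩ := EReal.lt_iff_exists_real_btwn.1 hpos
  have hc0 : 0 < c := by exact_mod_cast hc
  obtain ⟨R₀, hR₀⟩ := eventually_atTop.1 (eventually_lt_of_lt_liminf hcl)
  have hp1 : 0 < p - 1 := by linarith
  have hpq : p.HolderConjugate p.conjExponent := Real.HolderConjugate.conjExponent hp
  have hq : p.conjExponent = p / (p - 1) := rfl
  set q := p.conjExponent
  -- `ℓ ≥ 2q` is equivalent to `ℓ/p ≤ ℓ - 2`.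
  set ℓ : ℕ := ⌈2 * q⌉₊ + 3 with hℓ
  have hℓ3 : 3 ≤ ℓ := by omega
  have hℓq : 2 * q ≤ ℓ := by
    rw [hℓ]
    push_cast
    linarith [Nat.le_ceil (2 * q)]
  have hℓp : (ℓ : ℝ) / p ≤ ℓ - 2 := by
    rw [hq, ← mul_div_assoc, div_le_iff₀ hp1] at hℓq
    rw [div_le_iff₀ (by linarith)]
    linarith
  obtain ⟨K, hK, hKb⟩ := b.exists_integral_mul_logCutoff_le hpq hℓ3 hℓp
  set α : ℝ := (p + 1) / (p - 1) - S.homDim with hα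
  have hexp : (S.homDim : ℝ) + 1 - 2 * q = -α := by
    rw [hq, hα]
    field_simp
    ring
  rw [hexp] at hKb
  set R₁ : ℝ := max R₀ 1 with hR₁
  have hR₁1 : 1 ≤ R₁ := le_max_right _ _
  have hest : ∀ (R : ℝ) (n : ℕ) (T : EReal), R₁ ≤ R → 1 ≤ n →
      ((R * Real.exp n : ℝ) : EReal) < T → ∀ (σ : ℝ) (u₀ : S.Point → ℝ) (u : ℝ × S.Point → ℝ),
      0 < σ → b.IsWeakSolution p σ u₀ u₁ T u →
      σ * c ≤ K * (n : ℝ) ^ (-q) * ∑ k ∈ Finset.range n, (R * Real.exp k) ^ (-α) := by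
    intro R n T hR hn hT σ u₀ u hσ hu
    have hR1 : 1 ≤ R := hR₁1.trans hR
    refine le_trans ?_ (hKb R n T hR1 hn hT σ u₀ u₁ u hu)
    refine mul_le_mul_of_nonneg_left ?_ hσ.le
    refine Carnot.Stratification.le_integral_mul_logCutoff (by omega) hR1
      (by exact_mod_cast hn) hu₁ fun ρ hρ => ?_
    have := hR₀ ρ (((le_max_left _ _).trans hR).trans hρ)
    exact_mod_cast this.le
  have hR₁log : 0 ≤ Real.log R₁ := Real.log_nonneg hR₁1
  have hKc : 0 ≤ K / c := by positivity
  -- The summand `R₁ > 0` keeps the scale above `R₁` for `σ ≤ 1` and makes the final contradiction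
  -- strict; `exp 1` is the width of the single shell. When `α = 0` only the positivity of `C₁`
  -- matters.
  set C₁ : ℝ := (R₁ + (K / c) ^ α⁻¹) * Real.exp 1 with hC₁
  set C₂ : ℝ := Real.log R₁ + (K / c) ^ (p - 1) + 1 with hC₂
  have hC₁0 : 0 < C₁ := by positivity
  have hC₂0 : 0 < C₂ := by positivity
  refine ⟨1, one_pos, max C₁ C₂, lt_max_of_lt_left hC₁0, fun u₀ _ σ hσ hσ1 =>
    ⟨fun hlt => b.lifespan_le fun T hT u hu => ?_, fun heq => b.lifespan_le fun T hT u hu => ?_⟩⟩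
  · have hα0 : 0 < α := by
      rw [hα, sub_pos, lt_div_iff₀ hp1]
      linarith
    set D : ℝ := R₁ + (K / c) ^ α⁻¹ with hD
    have hKα : 0 ≤ (K / c) ^ α⁻¹ := Real.rpow_nonneg hKc _
    have hs : 1 ≤ σ ^ (-α⁻¹) :=
      Real.one_le_rpow_of_pos_of_le_one_of_nonpos hσ hσ1 (by simpa using hα0.le)
    have hRD : R₁ ≤ D * σ ^ (-α⁻¹) := by
      calc R₁ ≤ D * 1 := by linarith
        _ ≤ D * σ ^ (-α⁻¹) := by gcongr
    have hRT : ((D * σ ^ (-α⁻¹) * Real.exp (1 : ℕ) : ℝ) : EReal) < T := by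
      refine lt_of_le_of_lt (EReal.coe_le_coe_iff.2 ?_) hT
      calc D * σ ^ (-α⁻¹) * Real.exp (1 : ℕ) = C₁ * σ ^ (-α⁻¹) := by
            rw [hC₁, Nat.cast_one]
            ring
        _ ≤ max C₁ C₂ * σ ^ (-α⁻¹) := by
            gcongr
            exact le_max_left _ _
    have h := hest _ 1 T hRD le_rfl hRT σ u₀ u hσ hu
    simp only [Nat.cast_one, Real.one_rpow, mul_one, Finset.range_one, Finset.sum_singleton,
      Nat.cast_zero, Real.exp_zero] at h
    have := Carnot.le_of_mul_le_rpow_neg hc0 hσ hα0 rfl (by positivity) h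
    linarith
  · have hα0 : α = 0 := by
      rw [hα, sub_eq_zero, div_eq_iff hp1.ne']
      linarith
    set M : ℝ := (K / c) ^ (p - 1) with hM
    have hM0 : 0 ≤ M := Real.rpow_nonneg hKc _
    set s : ℝ := σ ^ (-(p - 1)) with hs
    have hs1 : 1 ≤ s := Real.one_le_rpow_of_pos_of_le_one_of_nonpos hσ hσ1 (by linarith)
    -- The least natural number strictly above `M s`, the bound that the estimate imposes on `n`.
    set n : ℕ := ⌊M * s⌋₊ + 1 with hn
    have hnle : (n : ℝ) ≤ M * s + 1 := by
      rw [hn]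
      push_cast
      linarith [Nat.floor_le (show 0 ≤ M * s by positivity)]
    have hnlt : M * s < n := by
      rw [hn]
      push_cast
      exact Nat.lt_floor_add_one _
    have hn0 : (0 : ℝ) < n := lt_of_le_of_lt (by positivity) hnlt
    have hRT : ((R₁ * Real.exp n : ℝ) : EReal) < T := by
      refine lt_of_le_of_lt (EReal.coe_le_coe_iff.2 ?_) hT
      rw [← Real.exp_log (show 0 < R₁ by linarith), ← Real.exp_add, Real.exp_le_exp]
      -- As `s ≥ 1`, the constants `log R₁` and `1` are absorbed into multiples of `s`.
      calc Real.log R₁ + n ≤ Real.log R₁ * s + (M * s + 1 * s) := by nlinarith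
        _ = C₂ * s := by ring
        _ ≤ max C₁ C₂ * s := by
            gcongr
            exact le_max_right _ _
    have h := hest R₁ n T le_rfl (by omega) hRT σ u₀ u hσ hu
    simp only [hα0, neg_zero, Real.rpow_zero, Finset.sum_const, Finset.card_range, nsmul_eq_mul,
      mul_one] at h
    -- `1 - q = -1/(p-1)`.
    have hpow : K * (n : ℝ) ^ (-q) * n = K * (n : ℝ) ^ (-(p - 1)⁻¹) := by
      rw [mul_assoc, ← Real.rpow_add_one hn0.ne']
      congr 2
      rw [hq]
      field_simp
      ring
    rw [hpow] at h
    have := Carnot.le_of_mul_le_rpow_neg_inv hc0 hσ hK hp1 hn0 h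
    linarith
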